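/- **Setting.** Let $c,n\ge 1$, let $\mathcal X\subset\mathbb R^d$, let $D$ be a probability distribution on $\mathcal X\times\{-1,+1\}^c$, and let $S=\{(\mathbf x_i,\mathbf y_i)\}_{i=1}^n$ be an i.i.d. sample from $D$. Let $\kappa:\mathcal X\times\mathcal X\to\mathbb R$ be a measurable positive (semi-)definite symmetric kernel with $\kappa(\mathbf x,\mathbf x)\le r^2$ for all $\mathbf x\in\mathcal X$, where $r>0$. Let $\phi:\mathcal X\to\mathbb H$ be a feature map of $\kappa$ into a real Hilbert space $\mathbb H$, i.e. $\langle\phi(\mathbf x),\phi(\mathbf x')\rangle=\kappa(\mathbf x,\mathbf x')$ (for instance the canonical feature map into the RKHS of $\kappa$). For $\Lambda\in\mathbb R$ put $$\mathcal F=\Big\{\mathbf x\mapsto(\langle \mathbf w_1,\phi(\mathbf x)\rangle,\dots,\langle \mathbf w_c,\phi(\mathbf x)\rangle)\;:\;\mathbf w_1,\dots,\mathbf w_c\in\mathbb H,\ \Big(\sum_{j=1}^c\|\mathbf w_j\|^2\Big)^{1/2}\le\Lambda\Big\}.$$ Let $sgn(u)=1$ for $u>0$ and $sgn(u)=-1$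 for $u\le 0$, applied coordinatewise to vectors. Let the base loss $\ell:\mathbb R\to\mathbb R$ be $\rho$-Lipschitz, let it dominate the $0/1$ loss, i.e. $[\![sgn(v)\ne y]\!]\le\ell(yv)$ for all $v\in\mathbb R$ and $y\in\{-1,+1\}$, and let it be bounded by $B$ on the range of margins of $\mathcal F$, i.e. $\ell(u)\le B$ whenever $|u|\le\Lambda r$. For $f\in\mathcal F$ define the $0/1$ subset risk, the $0/1$ ranking risk and the empirical surrogate subset risk by $$R^s_{0/1}(sgn\circ f)=\mathbb E_{(\mathbf x,\mathbf y)\sim D}\max_{1\le j\le c}[\![sgn(f_j(\mathbf x))\neq y_j]\!],$$ $$R^r_{0/1}(f)=\mathbb E_{(\mathbf x,\mathbf y)\sim D}\frac1{|Y^+||Y^-|}\sum_{p\in Y^+}\sum_{q\in Y^-}[\![f_p(\mathbf x)\le f_q(\mathbf x)]\!],$$ $$\hat R^s_S(f)=\frac1n\sum_{i=1}^n\max_{1\le j\le c}\ell\big(y_{ij}f_j(\mathbf x_i)\big),$$ where $Y^{\pm}=\{j:y_j=\pm1\}$, and the ranking loss is $0$ if $Y^+$ or $Y^-$ is empty. **Theorem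 (Optimize Subset Loss, Ranking Loss bound).** For every $f\in\mathcal F$ the two $0/1$ losses above are integrable with respect to $D$, and for every $\delta>0$, with probability at least $1-\delta$ over $S$, the following holds for all $f\in\mathcal F$ simultaneously: $$R^r_{0/1}(f)\;\le\; R^s_{0/1}(sgn\circ f)\;\le\;\hat R^s_S(f)+2\sqrt2\,\rho\sqrt{\frac{c\Lambda^2r^2}{n}}+3B\sqrt{\frac{\log(2/\delta)}{2n}}.$$ (For $\delta\ge 1$ the probability claim is trivial.) -/

import Mathlib

open scoped NNReal ENNReal

noncomputable section

namespace MultiLabel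

/-- Label vectors in `{-1, +1}^c`; the type `ℤˣ` is exactly `{1, -1}`. -/
abbrev Labels (c : ℕ) : Type := Fin c → ℤˣ

/-- A label in `{-1, +1}` regarded as a real number. -/
def labelVal (s : ℤˣ) : ℝ := ((s : ℤ) : ℝ)

/-- `sgn x = 1` if `x > 0`, and `sgn x = -1` otherwise (in particular `sgn 0 = -1`). -/
def sgn (x : ℝ) : ℤˣ := if 0 < x then 1 else -1

/-- The sign function applied to every coordinate of a score vector. -/
def sgnVec {c : ℕ} (v : Fin c → ℝ) : Labels c := fun j => sgn (v j)

/-- The 0/1 subset loss `max_j [[h_j ≠ y_j]]` of a predicted label vector `h`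
(a maximum over a finite index set, nonempty when `0 < c`). -/
def subsetLoss01 {c : ℕ} (h y : Labels c) : ℝ := ⨆ j : Fin c, if h j ≠ y j then (1 : ℝ) else 0

/-- The surrogate subset loss `max_j ℓ (y_j v_j)` of a score vector `v`. -/
def subsetLoss {c : ℕ} (ℓ : ℝ → ℝ) (v : Fin c → ℝ) (y : Labels c) : ℝ :=
  ⨆ j : Fin c, ℓ (labelVal (y j) * v j)

/-- The set `Y⁺` of relevant label indices. -/
def relevant {c : ℕ} (y : Labels c) : Finset (Fin c) := Finset.univ.filter fun j => y j = 1

/-- The set `Y⁻` of irrelevant label indices. -/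
def irrelevant {c : ℕ} (y : Labels c) : Finset (Fin c) := Finset.univ.filter fun j => y j = -1

/-- The 0/1 ranking loss: the fraction of pairs `(p, q) ∈ Y⁺ × Y⁻` with `v_p ≤ v_q`.
If `Y⁺` or `Y⁻` is empty there is no pair to rank and the loss is `0`. -/
def rankingLoss01 {c : ℕ} (v : Fin c → ℝ) (y : Labels c) : ℝ :=
  if (relevant y).Nonempty ∧ (irrelevant y).Nonempty then
    1 / (((relevant y).card : ℝ) * ((irrelevant y).card : ℝ)) *
      ∑ p ∈ relevant y, ∑ q ∈ irrelevant y, if v p ≤ v q then (1 : ℝ) else 0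
  else 0

/-- `‖W‖_{ℍ,2} = (∑_j ‖w_j‖²)^{1/2}`. -/
def weightNorm {H : Type*} [NormedAddCommGroup H] {c : ℕ} (W : Fin c → H) : ℝ :=
  Real.sqrt (∑ j, ‖W j‖ ^ 2)

/-- The kernel-based hypothesis set `{x ↦ (⟪w_1, φ x⟫, …, ⟪w_c, φ x⟫) : ‖W‖_{ℍ,2} ≤ Λ}`. -/
def kernelClass {X H : Type*} [NormedAddCommGroup H] [InnerProductSpace ℝ H]
    (c : ℕ) (φ : X → H) (Λ : ℝ) : Set (X → Fin c → ℝ) :=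
  {f | ∃ W : Fin c → H, weightNorm W ≤ Λ ∧ f = fun x j => inner ℝ (W j) (φ x)}

/-- Expected risk of a per-example loss `g` under the distribution `D`. -/
def risk {Z : Type*} [MeasurableSpace Z] (D : MeasureTheory.Measure Z) (g : Z → ℝ) : ℝ :=
  ∫ z, g z ∂D

/-- Empirical risk (sample average) of a per-example loss `g` on the sample `S`. -/
def empiricalRisk {Z : Type*} {n : ℕ} (S : Fin n → Z) (g : Z → ℝ) : ℝ :=
  1 / (n : ℝ) * ∑ i, g (S i)

end MultiLabel

end

open scoped BigOperators

namespace MultiLabel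

open Finset MeasureTheory ProbabilityTheory

/-! The left inequality holds pointwise: if all signs match the labels, every relevant score is
positive and every irrelevant one is not, so no pair is misranked; otherwise the subset loss is
already `1`. For the right inequality the 0/1 subset loss lies below the surrogate, and it remains
to bound risk minus empirical risk of the surrogate uniformly over the class.

That deviation is dominated by the expected deviation from an independent ghost sample. This
majorant moves by at most `B / n` when one sample point changes, so McDiarmid's inequality controls
its fluctuation, and random swaps with the ghost sample bound its mean by twice a Rademacher average
(`exists_measurableSet_uniform_deviation`). The Rademacher bound holds for every fixed sample, so
one concentration step suffices, and the factor 3 and the 2 in the logarithm are slack.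

For the Rademacher average, the maximum over labels is Lipschitz in the Euclidean norm of the
scores. Maurer's contraction (`expect_iSup_contraction`) therefore replaces each sign by `c`
independent signs acting on the scores, at the cost `√2 * ρ`; the `√2` is the optimal constant in
`khintchine`, obtained from a spectral gap on the cube. The remaining expression is linear in the
weights, and Cauchy–Schwarz with orthogonality of the signs bounds it.

Neither measurability of `φ` nor separability of `H` is assumed. On fixed points the supremum over
the class equals one over countably many clipped rational combinations of features
(`iSup_weights_eq_iSup_rat`), whose scores depend only on kernel values. -/

@[simp] lemma labelVal_one : labelVal 1 = 1 := by simp [labelVal]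

@[simp] lemma labelVal_neg (s : ℤˣ) : labelVal (-s) = -labelVal s := by simp [labelVal]

lemma labelVal_mul_self (s : ℤˣ) : labelVal s * labelVal s = 1 := by
  rcases Int.units_eq_one_or s with rfl | rfl <;> simp

lemma abs_labelVal (s : ℤˣ) : |labelVal s| = 1 := by
  rcases Int.units_eq_one_or s with rfl | rfl <;> simp

/-! ### Averages over signs, spectral gap of the cube, Khintchine's inequality -/

lemma expect_sign (f : ℤˣ → ℝ) : 𝔼 s, f s = (f 1 + f (-1)) / 2 := by
  rw [Fintype.expect_eq_sum_div_card]
  have : (univ : Finset ℤˣ) = {1, -1} := rfl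
  rw [this, sum_pair (by decide)]
  simp

lemma expect_pi_succ {α : Type*} [Fintype α] {n : ℕ} (f : (Fin (n + 1) → α) → ℝ) :
    𝔼 ε, f ε = 𝔼 s : α, 𝔼 ε : Fin n → α, f (Fin.cons s ε) := by
  rw [← expect_product' univ univ fun (s : α) (ε : Fin n → α) => f (Fin.cons s ε)]
  exact (Fintype.expect_equiv (Fin.consEquiv fun _ => α) _ _ fun _ => rfl).symm

lemma expect_signs_neg {ι : Type*} [Fintype ι] [DecidableEq ι] (f : (ι → ℤˣ) → ℝ) :
    𝔼 ε : ι → ℤˣ, f (-ε) = 𝔼 ε, f ε :=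
  Fintype.expect_equiv (Equiv.neg _) _ _ fun _ => rfl

/-- The sign vector `ε` with its `j`-th coordinate negated. -/
def flip {n : ℕ} (j : Fin n) (ε : Fin n → ℤˣ) : Fin n → ℤˣ := Function.update ε j (-ε j)

lemma flip_flip {n : ℕ} (j : Fin n) (ε : Fin n → ℤˣ) : flip j (flip j ε) = ε := by
  simp [flip]

lemma flip_zero_cons {n : ℕ} (s : ℤˣ) (ε : Fin n → ℤˣ) :
    flip 0 (Fin.cons s ε : Fin (n + 1) → ℤˣ) = Fin.cons (-s) ε := by
  simp [flip, Fin.update_cons_zero]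

lemma flip_succ_cons {n : ℕ} (j : Fin n) (s : ℤˣ) (ε : Fin n → ℤˣ) :
    flip j.succ (Fin.cons s ε : Fin (n + 1) → ℤˣ) = Fin.cons s (flip j ε) := by
  simp [flip, Fin.cons_update]

lemma expect_flip {n : ℕ} (j : Fin n) (f : (Fin n → ℤˣ) → ℝ) :
    𝔼 ε, f (flip j ε) = 𝔼 ε, f ε :=
  Fintype.expect_equiv ⟨flip j, flip j, flip_flip j, flip_flip j⟩ _ _ fun _ => rfl

/-- The Dirichlet form of the discrete cube. -/
noncomputable def cubeEnergy {n : ℕ} (f : (Fin n → ℤˣ) → ℝ) : ℝ :=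
  ∑ j, 𝔼 ε, ((f ε - f (flip j ε)) / 2) ^ 2

/-- Flipping the first coordinate exchanges the two facets of the cube, while every other flip stays
inside a facet. -/
lemma cubeEnergy_succ {n : ℕ} (f : (Fin (n + 1) → ℤˣ) → ℝ) :
    cubeEnergy f = (𝔼 ε : Fin n → ℤˣ, ((f (Fin.cons 1 ε) - f (Fin.cons (-1) ε)) / 2) ^ 2) +
      (cubeEnergy (fun ε => f (Fin.cons 1 ε)) + cubeEnergy fun ε => f (Fin.cons (-1) ε)) / 2 := by
  unfold cubeEnergy
  rw [Fin.sum_univ_succ, ← sum_add_distrib, sum_div]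
  congr 1
  · rw [expect_pi_succ, expect_sign]
    simp only [flip_zero_cons, neg_neg]
    rw [← expect_add_distrib, expect_div]
    refine expect_congr rfl fun ε _ => ?_
    ring
  · refine sum_congr rfl fun j _ => ?_
    rw [expect_pi_succ, expect_sign]
    simp only [flip_succ_cons]

lemma sq_expect_le {ι : Type*} [Fintype ι] [Nonempty ι] (f : ι → ℝ) :
    (𝔼 i, f i) ^ 2 ≤ 𝔼 i, f i ^ 2 := by
  have := expect_mul_sq_le_sq_mul_sq univ f (fun _ => 1)
  simpa using this

/-- Poincaré inequality on the discrete cube. -/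
lemma cube_poincare {n : ℕ} (f : (Fin n → ℤˣ) → ℝ) :
    (𝔼 ε, f ε ^ 2) - (𝔼 ε, f ε) ^ 2 ≤ cubeEnergy f := by
  induction n with
  | zero => simp [cubeEnergy]
  | succ n ih =>
    have h1 := ih fun ε => f (Fin.cons 1 ε)
    have h2 := ih fun ε => f (Fin.cons (-1) ε)
    have h3 := sq_expect_le fun ε : Fin n → ℤˣ => (f (Fin.cons 1 ε) - f (Fin.cons (-1) ε)) / 2
    rw [← expect_div, expect_sub_distrib] at h3
    rw [cubeEnergy_succ, expect_pi_succ, expect_pi_succ, expect_sign, expect_sign]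
    nlinarith

/-- The energy is a quadratic form. This passes from the two facets to the even and odd parts in the
first coordinate. -/
lemma cubeEnergy_parallelogram {n : ℕ} (f g : (Fin n → ℤˣ) → ℝ) :
    (cubeEnergy f + cubeEnergy g) / 2 =
      cubeEnergy (fun ε => (f ε + g ε) / 2) + cubeEnergy fun ε => (f ε - g ε) / 2 := by
  unfold cubeEnergy
  rw [← sum_add_distrib, ← sum_add_distrib, sum_div]
  refine sum_congr rfl fun j _ => ?_
  rw [← expect_add_distrib, ← expect_add_distrib, expect_div]
  exact expect_congr rfl fun ε _ => by ring

/-- The second spectral gap of the discrete cube: functions without first-order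
Fourier coefficients satisfy the Poincaré inequality with constant `1 / 2`. -/
lemma cube_poincare_two {n : ℕ} (f : (Fin n → ℤˣ) → ℝ) :
    2 * ((𝔼 ε, f ε ^ 2) - (𝔼 ε, f ε) ^ 2) ≤
      cubeEnergy f + ∑ j, (𝔼 ε, labelVal (ε j) * f ε) ^ 2 := by
  induction n with
  | zero => simp [cubeEnergy]
  | succ n ih =>
    -- The even part in the first coordinate gets the induction hypothesis, the odd part only the
    -- ordinary Poincaré inequality. The mean of the odd part, which the latter leaves over, is the
    -- first-order coefficient of the new coordinate (`h6`).
    have h1 := ih fun ε => (f (Fin.cons 1 ε) + f (Fin.cons (-1) ε)) / 2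
    have h2 := cube_poincare fun ε => (f (Fin.cons 1 ε) - f (Fin.cons (-1) ε)) / 2
    have h3 := cubeEnergy_parallelogram (fun ε => f (Fin.cons 1 ε)) fun ε => f (Fin.cons (-1) ε)
    have h4 : 𝔼 ε, f ε ^ 2 = (𝔼 ε : Fin n → ℤˣ, ((f (Fin.cons 1 ε) + f (Fin.cons (-1) ε)) / 2) ^ 2)
        + 𝔼 ε : Fin n → ℤˣ, ((f (Fin.cons 1 ε) - f (Fin.cons (-1) ε)) / 2) ^ 2 := by
      rw [expect_pi_succ, expect_sign, ← expect_add_distrib, ← expect_add_distrib, expect_div]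
      exact expect_congr rfl fun ε _ => by ring
    have h5 : 𝔼 ε, f ε = 𝔼 ε : Fin n → ℤˣ, (f (Fin.cons 1 ε) + f (Fin.cons (-1) ε)) / 2 := by
      rw [expect_pi_succ, expect_sign, ← expect_add_distrib, expect_div]
    have h6 : 𝔼 ε, labelVal (ε 0) * f ε =
        𝔼 ε : Fin n → ℤˣ, (f (Fin.cons 1 ε) - f (Fin.cons (-1) ε)) / 2 := by
      rw [expect_pi_succ, expect_sign, ← expect_add_distrib, expect_div]
      exact expect_congr rfl fun ε _ => by simp; ring
    have h7 (j : Fin n) : 𝔼 ε, labelVal (ε j.succ) * f ε = 𝔼 ε : Fin n → ℤˣ,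
        labelVal (ε j) * ((f (Fin.cons 1 ε) + f (Fin.cons (-1) ε)) / 2) := by
      rw [expect_pi_succ, expect_sign, ← expect_add_distrib, expect_div]
      exact expect_congr rfl fun ε _ => by simp; ring
    rw [cubeEnergy_succ, h4, h5, Fin.sum_univ_succ, h6]
    simp only [h7]
    linarith

lemma expect_labelVal_mul {ι : Type*} [Fintype ι] [DecidableEq ι] (i j : ι) :
    𝔼 ε : ι → ℤˣ, labelVal (ε i) * labelVal (ε j) = if i = j then 1 else 0 := by
  split_ifs with h
  · subst h
    simp [labelVal_mul_self]
  -- Negating coordinate `i` preserves the average but reverses the sign of the product.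
  · let e : (ι → ℤˣ) ≃ (ι → ℤˣ) :=
      ⟨fun ε => Function.update ε i (-ε i), fun ε => Function.update ε i (-ε i),
        fun ε => by simp, fun ε => by simp⟩
    have := Fintype.expect_equiv e (fun ε => labelVal (e ε i) * labelVal (e ε j))
      (fun ε => labelVal (ε i) * labelVal (ε j)) fun _ => rfl
    simp only [e, Equiv.coe_fn_mk, Function.update_self, Function.update_of_ne (Ne.symm h),
      labelVal_neg, neg_mul, expect_neg_distrib] at this
    linarith

lemma expect_norm_sq_signed_sum {ι H : Type*} [Fintype ι] [DecidableEq ι]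
    [NormedAddCommGroup H] [InnerProductSpace ℝ H] (v : ι → H) :
    𝔼 ε : ι → ℤˣ, ‖∑ i, labelVal (ε i) • v i‖ ^ 2 = ∑ i, ‖v i‖ ^ 2 := by
  have (ε : ι → ℤˣ) : ‖∑ i, labelVal (ε i) • v i‖ ^ 2 =
      ∑ i, ∑ j, labelVal (ε i) * labelVal (ε j) * inner ℝ (v i) (v j) := by
    rw [← real_inner_self_eq_norm_sq, sum_inner]
    refine sum_congr rfl fun i _ => ?_
    rw [inner_sum]
    refine sum_congr rfl fun j _ => ?_
    rw [real_inner_smul_left, real_inner_smul_right, mul_assoc]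
  simp only [this, expect_sum_comm, ← expect_mul, expect_labelVal_mul]
  simp [ite_mul]

/-- Khintchine's inequality with the optimal constant `√2`
(the argument of Latała and Oleszkiewicz). -/
lemma khintchine {n : ℕ} (v : Fin n → ℝ) :
    Real.sqrt (∑ j, v j ^ 2) ≤ Real.sqrt 2 * 𝔼 ε : Fin n → ℤˣ, |∑ j, labelVal (ε j) * v j| := by
  set f : (Fin n → ℤˣ) → ℝ := fun ε => |∑ j, labelVal (ε j) * v j| with hf
  have hf0 (ε) : 0 ≤ f ε := abs_nonneg _
  have hneg (ε) : f (-ε) = f ε := by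
    simp only [hf, Pi.neg_apply, labelVal_neg, neg_mul, sum_neg_distrib, abs_neg]
  have hodd (j : Fin n) : 𝔼 ε, labelVal (ε j) * f ε = 0 := by
    have := expect_signs_neg fun ε : Fin n → ℤˣ => labelVal (ε j) * f ε
    simp only [hneg, Pi.neg_apply, labelVal_neg, neg_mul, expect_neg_distrib] at this
    linarith
  have hsq : 𝔼 ε, f ε ^ 2 = ∑ j, v j ^ 2 := by
    have := expect_norm_sq_signed_sum v
    simpa [hf, sq_abs] using this
  -- Flip `j` subtracts `2 ε_j v_j` from the linear form, so the `n` flipped forms add up to `n - 2`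
  -- times it; the triangle inequality does the rest.
  have hflip (ε : Fin n → ℤˣ) : ((n : ℝ) - 2) * f ε ≤ ∑ j, f (flip j ε) := by
    have h1 (j : Fin n) : ∑ k, labelVal (flip j ε k) * v k =
        (∑ k, labelVal (ε k) * v k) - 2 * (labelVal (ε j) * v j) := by
      rw [← sum_erase_add _ _ (mem_univ j), ← sum_erase_add univ (fun k => labelVal (ε k) * v k)
        (mem_univ j)]
      have : ∀ k ∈ univ.erase j, labelVal (flip j ε k) * v k = labelVal (ε k) * v k := by
        intro k hk
        rw [flip, Function.update_of_ne (ne_of_mem_erase hk)]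
      rw [sum_congr rfl this]
      simp [flip]
      ring
    calc ((n : ℝ) - 2) * f ε ≤ |((n : ℝ) - 2) * ∑ k, labelVal (ε k) * v k| := by
          rw [abs_mul]
          exact mul_le_mul_of_nonneg_right (le_abs_self _) (abs_nonneg _)
      _ = |∑ j, ∑ k, labelVal (flip j ε k) * v k| := by
          simp only [h1, sum_sub_distrib, ← mul_sum]
          simp [sub_mul]
      _ ≤ _ := abs_sum_le_sum_abs _ _
  have hen : cubeEnergy f ≤ 𝔼 ε, f ε ^ 2 := by
    have h1 : cubeEnergy f = 𝔼 ε, f ε * (n * f ε - ∑ j, f (flip j ε)) / 2 := by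
      have h2 (j : Fin n) : 𝔼 ε, ((f ε - f (flip j ε)) / 2) ^ 2 =
          𝔼 ε, (f ε * (f ε - f (flip j ε))) / 2 := by
        have h3 : 𝔼 ε, ((f ε - f (flip j ε)) / 2) ^ 2 =
            (𝔼 ε, (f ε * (f ε - f (flip j ε))) / 2)
              - (𝔼 ε, f ε ^ 2) / 4 + (𝔼 ε, f (flip j ε) ^ 2) / 4 := by
          rw [expect_div, expect_div, ← expect_sub_distrib, ← expect_add_distrib]
          exact expect_congr rfl fun ε _ => by ring
        rw [h3, expect_flip j fun ε => f ε ^ 2]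
        ring
      rw [cubeEnergy, sum_congr rfl fun j _ => h2 j, ← expect_sum_comm]
      refine expect_congr rfl fun ε _ => ?_
      rw [← sum_div, ← mul_sum, sum_sub_distrib]
      simp
    rw [h1]
    refine expect_le_expect fun ε _ => ?_
    nlinarith [hflip ε, hf0 ε]
  -- Evenness of `f` kills the first-order terms. With energy at most `𝔼 f²` this gives `𝔼 f² ≤ 2 (𝔼
  -- f)²`.
  have hp := cube_poincare_two f
  simp only [hodd, ne_eq, OfNat.ofNat_ne_zero, not_false_eq_true, zero_pow, sum_const_zero,
    add_zero] at hp
  have hE : 0 ≤ 𝔼 ε, f ε := expect_nonneg fun ε _ => hf0 ε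
  rw [← Real.sqrt_sq hE, ← Real.sqrt_mul (by norm_num), ← hsq]
  exact Real.sqrt_le_sqrt (by linarith)

/-! ### Vector contraction -/

/-- A real-valued function with bounded range. -/
def IsBoundedFun {ι : Type*} (f : ι → ℝ) : Prop := ∃ C, ∀ i, |f i| ≤ C

namespace IsBoundedFun

variable {ι : Type*} {f g : ι → ℝ}

lemma bddAbove (hf : IsBoundedFun f) : BddAbove (Set.range f) := by
  obtain ⟨C, hC⟩ := hf
  exact ⟨C, by rintro _ ⟨i, rfl⟩; exact (le_abs_self _).trans (hC i)⟩

lemma add (hf : IsBoundedFun f) (hg : IsBoundedFun g) : IsBoundedFun fun i => f i + g i := by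
  obtain ⟨C, hC⟩ := hf
  obtain ⟨C', hC'⟩ := hg
  exact ⟨C + C', fun i => (abs_add_le _ _).trans (add_le_add (hC i) (hC' i))⟩

lemma const_mul (hf : IsBoundedFun f) (a : ℝ) : IsBoundedFun fun i => a * f i := by
  obtain ⟨C, hC⟩ := hf
  exact ⟨|a| * C, fun i => by
    rw [abs_mul]; exact mul_le_mul_of_nonneg_left (hC i) (abs_nonneg a)⟩

lemma sum {κ : Type*} (s : Finset κ) {F : κ → ι → ℝ} (hF : ∀ k, IsBoundedFun (F k)) :
    IsBoundedFun fun i => ∑ k ∈ s, F k i := by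
  choose C hC using hF
  exact ⟨∑ k ∈ s, C k, fun i => (abs_sum_le_sum_abs _ _).trans (sum_le_sum fun k _ => hC k i)⟩

end IsBoundedFun

/-- One step of the vector contraction inequality: a single Rademacher sign is replaced by
a Rademacher vector. -/
lemma expect_iSup_contraction_step {ι : Type*} [Nonempty ι] {c : ℕ} (ρ : ℝ) (hρ : 0 ≤ ρ)
    (G h : ι → ℝ) (ψ : ι → Fin c → ℝ) (hG : IsBoundedFun G) (hh : IsBoundedFun h)
    (hψ : ∀ j, IsBoundedFun fun i => ψ i j)
    (hlip : ∀ i i', |h i - h i'| ≤ ρ * Real.sqrt (∑ j, (ψ i j - ψ i' j) ^ 2)) :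
    𝔼 s : ℤˣ, ⨆ i, (G i + labelVal s * h i) ≤
      𝔼 σ : Fin c → ℤˣ, ⨆ i, (G i + Real.sqrt 2 * ρ * ∑ j, labelVal (σ j) * ψ i j) := by
  set L := Real.sqrt 2 * ρ with hL
  set a : ι → (Fin c → ℤˣ) → ℝ := fun i σ => ∑ j, labelVal (σ j) * ψ i j with ha
  set Φ : (Fin c → ℤˣ) → ℝ := fun σ => ⨆ i, (G i + L * a i σ) with hΦ
  have hb (σ : Fin c → ℤˣ) : BddAbove (Set.range fun i => G i + L * a i σ) :=
    (hG.add ((IsBoundedFun.sum univ fun j => (hψ j).const_mul _).const_mul L)).bddAbove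
  have haneg (i σ) : a i (-σ) = -a i σ := by simp [ha]
  have key (i i') : G i + h i + (G i' - h i') ≤ 2 * 𝔼 σ, Φ σ := by
    have h1 : h i - h i' ≤ 𝔼 σ, |L * a i σ - L * a i' σ| := by
      have h2 := khintchine fun j => ψ i j - ψ i' j
      have h3 (σ : Fin c → ℤˣ) :
          |L * a i σ - L * a i' σ| = L * |∑ j, labelVal (σ j) * (ψ i j - ψ i' j)| := by
        rw [← mul_sub, abs_mul, abs_of_nonneg (by positivity)]
        simp only [ha, mul_sub, sum_sub_distrib]
      simp only [h3, ← mul_expect]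
      calc h i - h i' ≤ ρ * Real.sqrt (∑ j, (ψ i j - ψ i' j) ^ 2) :=
            (le_abs_self _).trans (hlip i i')
        _ ≤ ρ * _ := mul_le_mul_of_nonneg_left h2 hρ
        _ = _ := by rw [hL]; ring
    -- Assigning `i, i'` to `σ, -σ` in either order gives two lower bounds; the larger one carries
    -- the absolute value.
    have h4 (σ) : G i + G i' + |L * a i σ - L * a i' σ| ≤ Φ σ + Φ (-σ) := by
      have e1 := le_ciSup (hb σ) i
      have e2 := le_ciSup (hb σ) i'
      have e3 := le_ciSup (hb (-σ)) i
      have e4 := le_ciSup (hb (-σ)) i'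
      simp only [haneg] at e3 e4
      simp only [hΦ, haneg]
      rcases abs_cases (L * a i σ - L * a i' σ) with ⟨h, _⟩ | ⟨h, _⟩ <;> rw [h] <;> linarith
    have h5 := expect_le_expect (s := univ) fun σ _ => h4 σ
    rw [expect_add_distrib, expect_add_distrib, expect_add_distrib, expect_signs_neg Φ,
      Fintype.expect_const, Fintype.expect_const] at h5
    linarith
  rw [expect_sign]
  have b1 : BddAbove (Set.range fun i => G i + h i) := (hG.add hh).bddAbove
  have h6 : (⨆ i, (G i + h i)) + ⨆ i, (G i - h i) ≤ 2 * 𝔼 σ, Φ σ := by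
    rw [← le_sub_iff_add_le]
    refine ciSup_le fun i => ?_
    rw [le_sub_iff_add_le, ← le_sub_iff_add_le']
    refine ciSup_le fun i' => ?_
    rw [le_sub_iff_add_le']
    exact key i i'
  simp only [labelVal_one, labelVal_neg, one_mul, neg_mul, ← sub_eq_add_neg]
  linarith

/-- Vector contraction inequality for Rademacher averages (Maurer). -/
lemma expect_iSup_contraction {ι : Type*} [Nonempty ι] {n c : ℕ} (ρ : ℝ) (hρ : 0 ≤ ρ)
    (G : ι → ℝ) (h : Fin n → ι → ℝ) (ψ : Fin n → ι → Fin c → ℝ) (hG : IsBoundedFun G)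
    (hh : ∀ k, IsBoundedFun (h k)) (hψ : ∀ k j, IsBoundedFun fun i => ψ k i j)
    (hlip : ∀ k i i', |h k i - h k i'| ≤ ρ * Real.sqrt (∑ j, (ψ k i j - ψ k i' j) ^ 2)) :
    𝔼 ε : Fin n → ℤˣ, ⨆ i, (G i + ∑ k, labelVal (ε k) * h k i) ≤
      𝔼 σ : Fin n → Fin c → ℤˣ,
        ⨆ i, (G i + Real.sqrt 2 * ρ * ∑ k, ∑ j, labelVal (σ k j) * ψ k i j) := by
  -- The offset `G` absorbs the terms not being treated: first the remaining scalar signs, then the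
  -- vector signs already introduced.
  induction n generalizing G with
  | zero => simp
  | succ n ih =>
    rw [expect_pi_succ, expect_pi_succ, expect_comm]
    simp only [Fin.sum_univ_succ, Fin.cons_zero, Fin.cons_succ]
    calc 𝔼 ε : Fin n → ℤˣ, 𝔼 s : ℤˣ,
          ⨆ i, (G i + (labelVal s * h 0 i + ∑ k, labelVal (ε k) * h k.succ i))
        = 𝔼 ε : Fin n → ℤˣ, 𝔼 s : ℤˣ,
          ⨆ i, ((G i + ∑ k, labelVal (ε k) * h k.succ i) + labelVal s * h 0 i) := by
          refine expect_congr rfl fun ε _ => expect_congr rfl fun s _ => ?_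
          congr 1; ext i; ring
      _ ≤ 𝔼 ε : Fin n → ℤˣ, 𝔼 σ : Fin c → ℤˣ, ⨆ i, ((G i + ∑ k, labelVal (ε k) * h k.succ i) +
            Real.sqrt 2 * ρ * ∑ j, labelVal (σ j) * ψ 0 i j) :=
          expect_le_expect fun ε _ => expect_iSup_contraction_step ρ hρ _ (h 0) (ψ 0)
            (hG.add (IsBoundedFun.sum univ fun k => (hh k.succ).const_mul _)) (hh 0) (hψ 0) (hlip 0)
      _ = 𝔼 σ : Fin c → ℤˣ, 𝔼 ε : Fin n → ℤˣ, ⨆ i,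
            ((G i + Real.sqrt 2 * ρ * ∑ j, labelVal (σ j) * ψ 0 i j) +
              ∑ k, labelVal (ε k) * h k.succ i) := by
          rw [expect_comm]
          refine expect_congr rfl fun ε _ => expect_congr rfl fun s _ => ?_
          congr 1; ext i; ring
      _ ≤ 𝔼 σ : Fin c → ℤˣ, 𝔼 τ : Fin n → Fin c → ℤˣ, ⨆ i,
            ((G i + Real.sqrt 2 * ρ * ∑ j, labelVal (σ j) * ψ 0 i j) +
              Real.sqrt 2 * ρ * ∑ k, ∑ j, labelVal (τ k j) * ψ k.succ i j) :=
          expect_le_expect fun σ _ => ih _ (fun k => h k.succ) (fun k => ψ k.succ)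
            (hG.add ((IsBoundedFun.sum univ fun j => (hψ 0 j).const_mul _).const_mul _))
            (fun k => hh k.succ) (fun k => hψ k.succ) fun k => hlip k.succ
      _ = _ := by
          refine expect_congr rfl fun ε _ => expect_congr rfl fun s _ => ?_
          congr 1; ext i; ring

/-! ### Rademacher average of the kernel class -/

/-- The weight tuples of the kernel class of radius `Λ`. -/
abbrev Weights (H : Type*) [NormedAddCommGroup H] (c : ℕ) (Λ : ℝ) : Type _ :=
  {W : Fin c → H // weightNorm W ≤ Λ}

section Weights

variable {H : Type*} [NormedAddCommGroup H] {c n : ℕ} {Λ r : ℝ}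

lemma weightNorm_nonneg (W : Fin c → H) : 0 ≤ weightNorm W := Real.sqrt_nonneg _

lemma norm_le_weightNorm (W : Fin c → H) (j : Fin c) : ‖W j‖ ≤ weightNorm W :=
  Real.le_sqrt_of_sq_le
    (single_le_sum (f := fun j => ‖W j‖ ^ 2) (fun _ _ => sq_nonneg _) (mem_univ j))

variable [InnerProductSpace ℝ H]

lemma abs_inner_weights_le (hΛ : 0 ≤ Λ) (W : Weights H c Λ) (j : Fin c) {v : H} (hv : ‖v‖ ≤ r) :
    |inner ℝ (W.1 j) v| ≤ Λ * r :=
  (abs_real_inner_le_norm _ _).trans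
    (mul_le_mul ((norm_le_weightNorm W.1 j).trans W.2) hv (norm_nonneg _) hΛ)

lemma sum_inner_le_weightNorm_mul (W u : Fin c → H) :
    ∑ j, inner ℝ (W j) (u j) ≤ weightNorm W * weightNorm u :=
  (sum_le_sum fun _ _ => real_inner_le_norm _ _).trans (Real.sum_mul_le_sqrt_mul_sqrt _ _ _)

/-- A sign matrix is a sign vector indexed by pairs, so orthogonality applies to the family of
vectors that vanishes off column `j`. -/
lemma expect_norm_sq_signed_sum_column (v : Fin n → H) (j : Fin c) :
    𝔼 σ : Fin n → Fin c → ℤˣ, ‖∑ k, labelVal (σ k j) • v k‖ ^ 2 = ∑ k, ‖v k‖ ^ 2 := by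
  have h := expect_norm_sq_signed_sum fun p : Fin n × Fin c => if p.2 = j then v p.1 else 0
  have h1 : ∑ p : Fin n × Fin c, ‖if p.2 = j then v p.1 else 0‖ ^ 2 = ∑ k, ‖v k‖ ^ 2 := by
    rw [Fintype.sum_prod_type]
    refine sum_congr rfl fun k _ => ?_
    rw [sum_eq_single j (fun b _ hb => by simp [hb]) (by simp)]
    simp
  rw [← h1, ← h]
  refine (Fintype.expect_equiv (Equiv.curry (Fin n) (Fin c) ℤˣ) _ _ fun τ => ?_).symm
  rw [Fintype.sum_prod_type]
  congr 2
  refine sum_congr rfl fun k _ => ?_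
  rw [sum_eq_single j (fun b _ hb => by simp [hb]) (by simp)]
  simp [Equiv.curry, Function.curry]

/-- The Rademacher average of the linear class of radius `Λ` on feature vectors of norm at
most `r`. -/
lemma expect_iSup_weights_le [Nonempty (Weights H c Λ)] (v : Fin n → H)
    (hv : ∀ k, ‖v k‖ ≤ r) :
    𝔼 σ : Fin n → Fin c → ℤˣ, ⨆ W : Weights H c Λ,
      ∑ k, ∑ j, labelVal (σ k j) * inner ℝ (W.1 j) (v k) ≤ Λ * Real.sqrt (c * n * r ^ 2) := by
  have hΛ : 0 ≤ Λ := (weightNorm_nonneg _).trans (Classical.arbitrary (Weights H c Λ)).2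
  set u : (Fin n → Fin c → ℤˣ) → Fin c → H := fun σ j => ∑ k, labelVal (σ k j) • v k with hu
  have h1 (σ : Fin n → Fin c → ℤˣ) : (⨆ W : Weights H c Λ,
      ∑ k, ∑ j, labelVal (σ k j) * inner ℝ (W.1 j) (v k)) ≤ Λ * weightNorm (u σ) := by
    refine ciSup_le fun W => ?_
    calc ∑ k, ∑ j, labelVal (σ k j) * inner ℝ (W.1 j) (v k)
        = ∑ j, inner ℝ (W.1 j) (u σ j) := by
          rw [sum_comm]
          simp only [hu, inner_sum, real_inner_smul_right]
      _ ≤ weightNorm W.1 * weightNorm (u σ) := sum_inner_le_weightNorm_mul _ _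
      _ ≤ _ := mul_le_mul_of_nonneg_right W.2 (weightNorm_nonneg _)
  have h2 : 𝔼 σ, weightNorm (u σ) ≤ Real.sqrt (c * n * r ^ 2) := by
    refine Real.le_sqrt_of_sq_le ((sq_expect_le _).trans ?_)
    have h3 (σ) : weightNorm (u σ) ^ 2 = ∑ j, ‖u σ j‖ ^ 2 :=
      Real.sq_sqrt (sum_nonneg fun _ _ => sq_nonneg _)
    simp only [h3, expect_sum_comm]
    simp only [hu, expect_norm_sq_signed_sum_column]
    calc ∑ _j : Fin c, ∑ k, ‖v k‖ ^ 2 ≤ ∑ _j : Fin c, ∑ _k : Fin n, r ^ 2 :=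
          sum_le_sum fun _ _ => sum_le_sum fun k _ =>
            pow_le_pow_left₀ (norm_nonneg _) (hv k) 2
      _ = _ := by simp [mul_assoc]
  calc _ ≤ 𝔼 σ, Λ * weightNorm (u σ) := expect_le_expect fun σ _ => h1 σ
    _ = Λ * 𝔼 σ, weightNorm (u σ) := by rw [mul_expect]
    _ ≤ _ := mul_le_mul_of_nonneg_left h2 hΛ

end Weights

/-- The surrogate subset loss is Lipschitz in the Euclidean norm of the scores. -/
lemma abs_subsetLoss_sub_le {c : ℕ} [NeZero c] {ℓ : ℝ → ℝ} {ρ : ℝ≥0} (hρ : LipschitzWith ρ ℓ)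
    (v v' : Fin c → ℝ) (y : Labels c) :
    |subsetLoss ℓ v y - subsetLoss ℓ v' y| ≤ ρ * Real.sqrt (∑ j, (v j - v' j) ^ 2) := by
  have key (v v' : Fin c → ℝ) :
      subsetLoss ℓ v y ≤ subsetLoss ℓ v' y + ρ * Real.sqrt (∑ j, (v j - v' j) ^ 2) := by
    refine ciSup_le fun j => ?_
    have h1 := le_ciSup (Set.finite_range fun j => ℓ (labelVal (y j) * v' j)).bddAbove j
    have h2 := hρ.dist_le_mul (labelVal (y j) * v j) (labelVal (y j) * v' j)
    rw [Real.dist_eq, Real.dist_eq, ← mul_sub, abs_mul, abs_labelVal, one_mul] at h2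
    -- A single coordinate is at most the Euclidean norm, so the maximum brings no factor of `c` at
    -- this stage.
    have h3 : |v j - v' j| ≤ Real.sqrt (∑ j, (v j - v' j) ^ 2) := by
      rw [← Real.sqrt_sq_eq_abs]
      exact Real.sqrt_le_sqrt (single_le_sum (f := fun j => (v j - v' j) ^ 2)
        (fun _ _ => sq_nonneg _) (mem_univ j))
    have h4 := mul_le_mul_of_nonneg_left h3 ρ.2
    have h5 := le_abs_self (ℓ (labelVal (y j) * v j) - ℓ (labelVal (y j) * v' j))
    simp only [subsetLoss]
    simp only [NNReal.val_eq_coe] at h4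
    linarith
  rw [abs_sub_le_iff]
  refine ⟨by linarith [key v v'], ?_⟩
  have := key v' v
  simp only [fun j => show (v' j - v j) ^ 2 = (v j - v' j) ^ 2 by ring] at this
  linarith

/-- The Rademacher average of the surrogate subset losses of the kernel class. -/
lemma expect_iSup_subsetLoss_le {H : Type*} [NormedAddCommGroup H] [InnerProductSpace ℝ H]
    {c n : ℕ} [NeZero c] {Λ r : ℝ} [Nonempty (Weights H c Λ)]
    {ℓ : ℝ → ℝ} {ρ : ℝ≥0} (hρ : LipschitzWith ρ ℓ) (v : Fin n → H) (hv : ∀ k, ‖v k‖ ≤ r)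
    (y : Fin n → Labels c)
    (hℓ : ∀ k, IsBoundedFun fun W : Weights H c Λ =>
      subsetLoss ℓ (fun j => inner ℝ (W.1 j) (v k)) (y k)) :
    𝔼 ε : Fin n → ℤˣ, ⨆ W : Weights H c Λ,
      ∑ k, labelVal (ε k) * subsetLoss ℓ (fun j => inner ℝ (W.1 j) (v k)) (y k) ≤
        Real.sqrt 2 * ρ * (Λ * Real.sqrt (c * n * r ^ 2)) := by
  have hΛ : 0 ≤ Λ := (weightNorm_nonneg _).trans (Classical.arbitrary (Weights H c Λ)).2
  have h := expect_iSup_contraction (ι := Weights H c Λ) (ρ : ℝ) ρ.2 (fun _ => 0)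
    (fun k W => subsetLoss ℓ (fun j => inner ℝ (W.1 j) (v k)) (y k))
    (fun k W j => inner ℝ (W.1 j) (v k)) ⟨0, by simp⟩ hℓ
    (fun k j => ⟨Λ * r, fun W => abs_inner_weights_le hΛ W j (hv k)⟩)
    fun k W W' => abs_subsetLoss_sub_le hρ _ _ _
  simp only [zero_add] at h
  refine h.trans ?_
  have hL : (0 : ℝ) ≤ Real.sqrt 2 * ρ := by positivity
  simp only [← Real.mul_iSup_of_nonneg hL, ← mul_expect]
  exact mul_le_mul_of_nonneg_left (expect_iSup_weights_le v hv) hL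

/-! ### Bounded differences and McDiarmid's inequality -/

lemma IsBoundedFun.integrable {α : Type*} [MeasurableSpace α] {μ : Measure α} [IsFiniteMeasure μ]
    {f : α → ℝ} (hf : IsBoundedFun f) (hm : Measurable f) : Integrable f μ := by
  obtain ⟨C, hC⟩ := hf
  exact Integrable.of_bound hm.aestronglyMeasurable C (ae_of_all _ hC)

lemma abs_integral_le_of_forall_abs_le {α : Type*} [MeasurableSpace α] {μ : Measure α}
    [IsProbabilityMeasure μ] {f : α → ℝ} {C : ℝ} (hf : ∀ x, |f x| ≤ C) : |∫ x, f x ∂μ| ≤ C := by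
  simpa using norm_integral_le_of_norm_le_const (μ := μ) (f := f) (ae_of_all _ hf)

lemma IsBoundedFun.sub_const {α : Type*} {f : α → ℝ} (hf : IsBoundedFun f) (a : ℝ) :
    IsBoundedFun fun x => f x - a :=
  hf.add ⟨|-a|, fun _ => le_rfl⟩

lemma IsBoundedFun.exp_mul {α : Type*} {f : α → ℝ} (hf : IsBoundedFun f) (t : ℝ) :
    IsBoundedFun fun x => Real.exp (t * f x) := by
  obtain ⟨C, hC⟩ := hf.const_mul t
  exact ⟨Real.exp C, fun x => by
    rw [Real.abs_exp]; exact Real.exp_le_exp.2 ((le_abs_self _).trans (hC x))⟩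

section Pi

variable {Z : Type*} [MeasurableSpace Z] (D : Measure Z) [IsProbabilityMeasure D]

lemma piFinSuccAbove_zero_symm_apply {n : ℕ} (p : Z × (Fin n → Z)) :
    (MeasurableEquiv.piFinSuccAbove (fun _ : Fin (n + 1) => Z) 0).symm p = Fin.cons p.1 p.2 := by
  simp [MeasurableEquiv.piFinSuccAbove_symm_apply, Fin.insertNthEquiv]

lemma integral_pi_succ {n : ℕ} (F : (Fin (n + 1) → Z) → ℝ) :
    ∫ S, F S ∂(Measure.pi fun _ : Fin (n + 1) => D) =
      ∫ p : Z × (Fin n → Z), F (Fin.cons p.1 p.2) ∂(D.prod (Measure.pi fun _ : Fin n => D)) := by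
  have h := (measurePreserving_piFinSuccAbove (fun _ : Fin (n + 1) => D) 0).symm
  rw [← h.integral_comp' F]
  simp only [piFinSuccAbove_zero_symm_apply]

lemma measurable_fin_cons {n : ℕ} :
    Measurable fun p : Z × (Fin n → Z) => (Fin.cons p.1 p.2 : Fin (n + 1) → Z) := by
  simp only [← piFinSuccAbove_zero_symm_apply]
  exact (MeasurableEquiv.piFinSuccAbove (fun _ : Fin (n + 1) => Z) 0).symm.measurable

variable {D}

/-- The exponential moment bound behind McDiarmid's inequality. -/
lemma integral_exp_sub_integral_le {n : ℕ} {b : ℝ} (t : ℝ) {M : (Fin n → Z) → ℝ}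
    (hM : Measurable M) (hbd : IsBoundedFun M)
    (hdiff : ∀ S k z, |M (Function.update S k z) - M S| ≤ b) :
    ∫ S, Real.exp (t * (M S - ∫ S', M S' ∂(Measure.pi fun _ => D))) ∂(Measure.pi fun _ => D) ≤
      Real.exp (n * (b / 2) ^ 2 * t ^ 2 / 2) := by
  induction n with
  | zero =>
    have h : ∀ S, M S = M default := fun S => by rw [Subsingleton.elim S default]
    simp [h]
  | succ n ih =>
    have hMc : Measurable fun p : Z × (Fin n → Z) => M (Fin.cons p.1 p.2) :=
      hM.comp measurable_fin_cons
    obtain ⟨C, hC⟩ := hbd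
    -- Averaging out the first coordinate keeps bounded differences and the mean, so induction
    -- handles `N`; Hoeffding's lemma handles `M - N` on each section.
    set N : (Fin n → Z) → ℝ := fun S' => ∫ z, M (Fin.cons z S') ∂D with hN
    have hNm : Measurable N := (hMc.stronglyMeasurable.integral_prod_left' (μ := D)).measurable
    have hNb : IsBoundedFun N := ⟨C, fun S' => abs_integral_le_of_forall_abs_le fun z => hC _⟩
    have hsec (S' : Fin n → Z) : Measurable fun z => M (Fin.cons z S') :=
      hMc.comp (measurable_id.prodMk measurable_const)
    have hseci (S' : Fin n → Z) : Integrable (fun z => M (Fin.cons z S')) D :=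
      IsBoundedFun.integrable ⟨C, fun z => hC _⟩ (hsec S')
    have hNd : ∀ S k z, |N (Function.update S k z) - N S| ≤ b := fun S k z => by
      rw [hN, ← integral_sub (hseci _) (hseci _)]
      refine abs_integral_le_of_forall_abs_le fun x => ?_
      rw [Fin.cons_update]
      exact hdiff _ _ _
    have hmean : ∫ S, M S ∂(Measure.pi fun _ : Fin (n + 1) => D) =
        ∫ S', N S' ∂(Measure.pi fun _ => D) := by
      rw [integral_pi_succ, integral_prod_symm _
        (IsBoundedFun.integrable ⟨C, fun _ => hC _⟩ hMc)]
    set m := ∫ S', N S' ∂(Measure.pi fun _ : Fin n => D) with hm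
    have hinner (S' : Fin n → Z) : ∫ z, Real.exp (t * (M (Fin.cons z S') - m)) ∂D ≤
        Real.exp ((b / 2) ^ 2 * t ^ 2 / 2) * Real.exp (t * (N S' - m)) := by
      have : Nonempty Z := nonempty_of_isProbabilityMeasure D
      have hlow : BddBelow (Set.range fun z => M (Fin.cons z S')) :=
        ⟨-C, by rintro _ ⟨z, rfl⟩; exact (abs_le.1 (hC _)).1⟩
      have hoff (z z' : Z) : M (Fin.cons z S') ≤ M (Fin.cons z' S') + b := by
        have := hdiff (Fin.cons z' S') 0 z
        rw [Fin.update_cons_zero] at this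
        linarith [le_abs_self (M (Fin.cons z S') - M (Fin.cons z' S'))]
      -- Each section oscillates by at most `b`, so it lies in an interval of length `b` starting at
      -- its infimum.
      have hsub := hasSubgaussianMGF_of_mem_Icc (μ := D) (a := ⨅ z, M (Fin.cons z S'))
        (b := (⨅ z, M (Fin.cons z S')) + b) (hsec S').aemeasurable
        (ae_of_all _ fun z => ⟨ciInf_le hlow z, by
          rw [← sub_le_iff_le_add]
          exact le_ciInf fun z' => by linarith [hoff z z']⟩)
      have h1 := hsub.mgf_le t
      simp only [mgf, add_sub_cancel_left, NNReal.coe_pow, NNReal.coe_div, coe_nnnorm,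
        Real.norm_eq_abs, NNReal.coe_ofNat, div_pow, sq_abs] at h1
      calc ∫ z, Real.exp (t * (M (Fin.cons z S') - m)) ∂D
          = (∫ z, Real.exp (t * (M (Fin.cons z S') - N S')) ∂D) * Real.exp (t * (N S' - m)) := by
            rw [← integral_mul_const]
            refine integral_congr_ae (ae_of_all _ fun z => ?_)
            simp only [← Real.exp_add]
            congr 1; ring
        _ ≤ _ := by
            refine mul_le_mul_of_nonneg_right ?_ (Real.exp_pos _).le
            rw [div_pow]
            exact h1
    have hMb : IsBoundedFun fun p : Z × (Fin n → Z) => M (Fin.cons p.1 p.2) := ⟨C, fun _ => hC _⟩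
    have hint : Integrable (fun p : Z × (Fin n → Z) => Real.exp (t * (M (Fin.cons p.1 p.2) - m)))
        (D.prod (Measure.pi fun _ : Fin n => D)) :=
      ((hMb.sub_const m).exp_mul t).integrable
        (Real.measurable_exp.comp ((hMc.sub_const m).const_mul t))
    rw [hmean, integral_pi_succ, integral_prod_symm _ hint]
    calc _ ≤ ∫ S', Real.exp ((b / 2) ^ 2 * t ^ 2 / 2) * Real.exp (t * (N S' - m))
          ∂(Measure.pi fun _ : Fin n => D) :=
          integral_mono hint.integral_prod_right
            ((((hNb.sub_const m).exp_mul t).integrable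
              (Real.measurable_exp.comp ((hNm.sub_const m).const_mul t))).const_mul _) hinner
      _ ≤ Real.exp ((b / 2) ^ 2 * t ^ 2 / 2) * Real.exp (n * (b / 2) ^ 2 * t ^ 2 / 2) := by
          rw [integral_const_mul]
          exact mul_le_mul_of_nonneg_left (ih hNm hNb hNd) (Real.exp_pos _).le
      _ = _ := by
          rw [← Real.exp_add]
          congr 1; push_cast; ring

/-- McDiarmid's inequality: functions with bounded differences are sub-Gaussian. -/
lemma hasSubgaussianMGF_of_bounded_differences {n : ℕ} {b : ℝ≥0} {M : (Fin n → Z) → ℝ}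
    (hM : Measurable M) (hbd : IsBoundedFun M)
    (hdiff : ∀ S k z, |M (Function.update S k z) - M S| ≤ b) :
    HasSubgaussianMGF (fun S => M S - ∫ S', M S' ∂(Measure.pi fun _ => D)) (n * (b / 2) ^ 2)
      (Measure.pi fun _ => D) where
  integrable_exp_mul t := ((hbd.sub_const _).exp_mul t).integrable
    (Real.measurable_exp.comp ((hM.sub_const _).const_mul t))
  mgf_le t := by
    have := integral_exp_sub_integral_le (D := D) t hM hbd hdiff
    simpa [mgf] using this

end Pi

/-! ### Symmetrization and uniform deviation -/

section Symmetrization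

variable {Z ι : Type*}

/-- The supremum over a class `g` of the difference of the sums over a sample and a ghost sample. -/
noncomputable def ghostDeviation {n : ℕ} (g : ι → Z → ℝ) (T : Fin n → Z × Z) : ℝ :=
  ⨆ i, ∑ k, (g i (T k).2 - g i (T k).1)

variable {n : ℕ} {g : ι → Z → ℝ} {B : ℝ}

lemma abs_sum_ghost_le (hg : ∀ i z, g i z ∈ Set.Icc 0 B) (T : Fin n → Z × Z) (i : ι) :
    |∑ k, (g i (T k).2 - g i (T k).1)| ≤ n * B := by
  refine (abs_sum_le_sum_abs _ _).trans ((sum_le_sum fun k _ => ?_).trans_eq (by simp :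
    ∑ _k : Fin n, B = n * B))
  rw [abs_le]
  constructor <;> linarith [(hg i (T k).1).1, (hg i (T k).1).2, (hg i (T k).2).1, (hg i (T k).2).2]

lemma bddAbove_ghost (hg : ∀ i z, g i z ∈ Set.Icc 0 B) (T : Fin n → Z × Z) :
    BddAbove (Set.range fun i => ∑ k, (g i (T k).2 - g i (T k).1)) :=
  IsBoundedFun.bddAbove ⟨n * B, abs_sum_ghost_le hg T⟩

lemma abs_ghostDeviation_le [Nonempty ι] (hg : ∀ i z, g i z ∈ Set.Icc 0 B) (T : Fin n → Z × Z) :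
    |ghostDeviation g T| ≤ n * B := by
  rw [abs_le]
  refine ⟨?_, ciSup_le fun i => (abs_le.1 (abs_sum_ghost_le hg T i)).2⟩
  exact (abs_le.1 (abs_sum_ghost_le hg T (Classical.arbitrary ι))).1.trans
    (le_ciSup (bddAbove_ghost hg T) _)

/-- Only one summand changes, and by at most `B`, as both losses lie in `[0, B]`. -/
lemma ghostDeviation_update_le [Nonempty ι] (hg : ∀ i z, g i z ∈ Set.Icc 0 B)
    (S S' : Fin n → Z) (k : Fin n) (z : Z) :
    ghostDeviation g (fun j => (Function.update S k z j, S' j)) ≤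
      ghostDeviation g (fun j => (S j, S' j)) + B := by
  refine ciSup_le fun i => ?_
  have h1 := le_ciSup (bddAbove_ghost hg fun j => (S j, S' j)) i
  have h2 : ∑ j, (g i (S' j) - g i (Function.update S k z j)) ≤
      ∑ j, (g i (S' j) - g i (S j)) + B := by
    rw [← sum_erase_add _ _ (mem_univ k),
      ← sum_erase_add univ (fun j => g i (S' j) - g i (S j)) (mem_univ k)]
    have : ∀ j ∈ univ.erase k, g i (S' j) - g i (Function.update S k z j) =
        g i (S' j) - g i (S j) := fun j hj => by
      rw [Function.update_of_ne (ne_of_mem_erase hj)]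
    rw [sum_congr rfl this, Function.update_self]
    linarith [(hg i z).1, (hg i (S k)).2]
  exact h2.trans (add_le_add_left h1 B)

/-- Exchanging the two halves of the pairs at the coordinates with negative sign. -/
def signSwap (ε : Fin n → ℤˣ) (T : Fin n → Z × Z) : Fin n → Z × Z :=
  fun k => if ε k = 1 then T k else (T k).swap

/-- Swapping a pair negates its summand, so a measure-preserving swap acts as a Rademacher sign. -/
lemma ghostDeviation_signSwap (ε : Fin n → ℤˣ) (T : Fin n → Z × Z) :
    ghostDeviation g (signSwap ε T) =
      ⨆ i, ∑ k, labelVal (ε k) * (g i (T k).2 - g i (T k).1) := by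
  unfold ghostDeviation
  congr 1; ext i
  refine sum_congr rfl fun k _ => ?_
  rcases Int.units_eq_one_or (ε k) with h | h <;> simp [signSwap, h]

lemma bddAbove_signed (hg : ∀ i z, g i z ∈ Set.Icc 0 B) (ε : Fin n → ℤˣ) (S : Fin n → Z) :
    BddAbove (Set.range fun i => ∑ k, labelVal (ε k) * g i (S k)) :=
  (IsBoundedFun.sum univ fun k => IsBoundedFun.const_mul
    ⟨B, fun i => by rw [abs_of_nonneg (hg i _).1]; exact (hg i _).2⟩ _).bddAbove

variable [MeasurableSpace Z] {D : Measure Z} [IsProbabilityMeasure D]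

lemma measurable_zip : Measurable fun p : (Fin n → Z) × (Fin n → Z) =>
    (fun k => (p.1 k, p.2 k) : Fin n → Z × Z) :=
  (MeasurableEquiv.arrowProdEquivProdArrow Z Z (Fin n)).symm.measurable

lemma measurePreserving_signSwap (ε : Fin n → ℤˣ) :
    MeasurePreserving (signSwap ε) (Measure.pi fun _ : Fin n => D.prod D)
      (Measure.pi fun _ => D.prod D) := by
  refine measurePreserving_pi (fun _ => D.prod D) (fun _ => D.prod D)
    (f := fun k p => if ε k = 1 then p else p.swap) fun k => ?_
  by_cases h : ε k = 1
  · simp only [h, if_true]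
    exact MeasurePreserving.id _
  · simpa [h] using Measure.measurePreserving_swap (μ := D) (ν := D)

/-- Symmetrization by Rademacher signs. -/
lemma integral_ghostDeviation_le [Nonempty ι] (hg : ∀ i z, g i z ∈ Set.Icc 0 B)
    (hΨ : Measurable (ghostDeviation (n := n) g)) {R : ℝ}
    (hR : ∀ S : Fin n → Z, 𝔼 ε : Fin n → ℤˣ, ⨆ i, ∑ k, labelVal (ε k) * g i (S k) ≤ R) :
    ∫ T, ghostDeviation g T ∂(Measure.pi fun _ : Fin n => D.prod D) ≤ 2 * R := by
  have hmeas (ε : Fin n → ℤˣ) : Measurable fun T : Fin n → Z × Z => ghostDeviation g (signSwap ε T) :=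
    hΨ.comp (measurePreserving_signSwap (D := D) ε).measurable
  have hint (ε : Fin n → ℤˣ) : Integrable (fun T => ghostDeviation g (signSwap ε T))
      (Measure.pi fun _ : Fin n => D.prod D) :=
    IsBoundedFun.integrable ⟨n * B, fun _ => abs_ghostDeviation_le hg _⟩ (hmeas ε)
  have h1 (ε : Fin n → ℤˣ) : ∫ T, ghostDeviation g (signSwap ε T)
      ∂(Measure.pi fun _ : Fin n => D.prod D) =
      ∫ T, ghostDeviation g T ∂(Measure.pi fun _ : Fin n => D.prod D) := by
    have h := measurePreserving_signSwap (D := D) ε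
    rw [← integral_map h.measurable.aemeasurable hΨ.aestronglyMeasurable, h.map_eq]
  have h2 : ∫ T, ghostDeviation g T ∂(Measure.pi fun _ : Fin n => D.prod D) =
      ∫ T, 𝔼 ε, ghostDeviation g (signSwap ε T) ∂(Measure.pi fun _ : Fin n => D.prod D) := by
    simp only [Fintype.expect_eq_sum_div_card]
    rw [integral_div, integral_finsetSum _ fun ε _ => hint ε]
    simp [h1]
  have h3 (T : Fin n → Z × Z) : 𝔼 ε, ghostDeviation g (signSwap ε T) ≤ 2 * R := by
    have e1 := hR fun k => (T k).2
    have e2 := hR fun k => (T k).1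
    -- The first half enters with a minus sign, which is absorbed by averaging over `-ε`.
    rw [← expect_signs_neg] at e2
    calc _ ≤ 𝔼 ε : Fin n → ℤˣ, ((⨆ i, ∑ k, labelVal (ε k) * g i (T k).2) +
          ⨆ i, ∑ k, labelVal ((-ε) k) * g i (T k).1) := by
          refine expect_le_expect fun ε _ => ?_
          rw [ghostDeviation_signSwap]
          refine ciSup_le fun i => ?_
          have a1 := le_ciSup (bddAbove_signed hg ε fun k => (T k).2) i
          have a2 := le_ciSup (bddAbove_signed hg (-ε) fun k => (T k).1) i
          refine le_trans (le_of_eq ?_) (add_le_add a1 a2)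
          rw [← sum_add_distrib]
          exact sum_congr rfl fun k _ => by simp; ring
      _ ≤ _ := by
          rw [expect_add_distrib]
          linarith
  rw [h2]
  refine (integral_mono ?_ (integrable_const (2 * R)) h3).trans_eq (by simp)
  simp only [Fintype.expect_eq_sum_div_card]
  exact (integrable_finsetSum _ fun ε _ => hint ε).div_const _

/-- Uniform deviation bound for a class of losses in `[0, B]` through its Rademacher averages. -/
theorem exists_measurableSet_uniform_deviation [Nonempty ι] (hn : 0 < n)
    (hgm : ∀ i, Measurable (g i)) (hB : 0 < B) (hg : ∀ i z, g i z ∈ Set.Icc 0 B)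
    (hΨ : Measurable (ghostDeviation (n := n) g)) {R : ℝ}
    (hR : ∀ S : Fin n → Z, 𝔼 ε : Fin n → ℤˣ, ⨆ i, ∑ k, labelVal (ε k) * g i (S k) ≤ R)
    {δ : ℝ} (hδ : 0 < δ) (hδ1 : δ < 1) :
    ∃ E : Set (Fin n → Z), MeasurableSet E ∧
      ENNReal.ofReal (1 - δ) ≤ Measure.pi (fun _ : Fin n => D) E ∧
      ∀ S ∈ E, ∀ i, ∫ z, g i z ∂D ≤ 1 / (n : ℝ) * ∑ k, g i (S k) + 2 * R / n +
        B * Real.sqrt (Real.log (1 / δ) / (2 * n)) := by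
  have hn' : (0 : ℝ) < n := by exact_mod_cast hn
  set P := Measure.pi fun _ : Fin n => D with hP
  have hΨp : Measurable fun p : (Fin n → Z) × (Fin n → Z) =>
      ghostDeviation g fun k => (p.1 k, p.2 k) := hΨ.comp measurable_zip
  have hΨi (S : Fin n → Z) : Integrable (fun S' => ghostDeviation g fun k => (S k, S' k)) P :=
    IsBoundedFun.integrable ⟨n * B, fun _ => abs_ghostDeviation_le hg _⟩
      (hΨp.comp (measurable_const.prodMk measurable_id))
  -- Integrating out the ghost sample gives a measurable majorant of all risk deviations (`hrisk`),
  -- so their own supremum need not be shown measurable.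
  set M : (Fin n → Z) → ℝ := fun S => 1 / (n : ℝ) * ∫ S', ghostDeviation g (fun k => (S k, S' k)) ∂P
    with hM
  have hMm : Measurable M :=
    ((hΨp.stronglyMeasurable.integral_prod_right' (ν := P)).measurable).const_mul _
  have hMb : IsBoundedFun M := IsBoundedFun.const_mul ⟨n * B, fun S =>
    abs_integral_le_of_forall_abs_le fun S' => abs_ghostDeviation_le hg _⟩ _
  have hup (S : Fin n → Z) (k : Fin n) (z : Z) : M (Function.update S k z) ≤ M S + B / n := by
    have : ∫ S', ghostDeviation g (fun j => (Function.update S k z j, S' j)) ∂P ≤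
        (∫ S', ghostDeviation g (fun j => (S j, S' j)) ∂P) + B := by
      refine (integral_mono (hΨi _) ((hΨi S).add (integrable_const B)) fun S' =>
        ghostDeviation_update_le hg S S' k z).trans_eq ?_
      simp only [Pi.add_apply]
      rw [integral_add (hΨi S) (integrable_const B)]
      simp
    have := mul_le_mul_of_nonneg_left this (by positivity : (0 : ℝ) ≤ 1 / n)
    simp only [hM]
    linarith [show 1 / (n : ℝ) * B = B / n by ring]
  set b : ℝ≥0 := ⟨B / n, by positivity⟩ with hb
  have hdiff : ∀ S k z, |M (Function.update S k z) - M S| ≤ b := fun S k z => by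
    have h1 := hup S k z
    -- Restoring the old point turns the one-sided bound into a two-sided one.
    have h2 := hup (Function.update S k z) k (S k)
    rw [Function.update_idem, Function.update_eq_self] at h2
    change _ ≤ B / n
    rw [abs_le]
    constructor <;> linarith
  have hmean : ∫ S, M S ∂P ≤ 2 * R / n := by
    have h1 : ∫ S, ∫ S', ghostDeviation g (fun k => (S k, S' k)) ∂P ∂P =
        ∫ T, ghostDeviation g T ∂(Measure.pi fun _ : Fin n => D.prod D) := by
      rw [← integral_prod (fun p : (Fin n → Z) × (Fin n → Z) =>
        ghostDeviation g fun k => (p.1 k, p.2 k))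
        (IsBoundedFun.integrable ⟨n * B, fun _ => abs_ghostDeviation_le hg _⟩ hΨp)]
      exact ((measurePreserving_arrowProdEquivProdArrow Z Z (Fin n) (fun _ => D)
        fun _ => D).symm).integral_comp' (ghostDeviation g)
    rw [hM, integral_const_mul, h1, one_div, inv_mul_eq_div]
    exact div_le_div_of_nonneg_right (integral_ghostDeviation_le hg hΨ hR) hn'.le
  have hrisk (S : Fin n → Z) (i : ι) :
      ∫ z, g i z ∂D - 1 / (n : ℝ) * ∑ k, g i (S k) ≤ M S := by
    have hgi : Integrable (g i) D :=
      Integrable.of_mem_Icc 0 B (hgm i).aemeasurable (ae_of_all _ (hg i))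
    have hev (k : Fin n) : Integrable (fun S' : Fin n → Z => g i (S' k)) P :=
      Integrable.of_mem_Icc 0 B ((hgm i).comp (measurable_pi_apply k)).aemeasurable
        (ae_of_all _ fun S' => hg i (S' k))
    have h1 : ∫ S', ∑ k, (g i (S' k) - g i (S k)) ∂P =
        n * ∫ z, g i z ∂D - ∑ k, g i (S k) := by
      rw [integral_finsetSum _ fun k _ => by exact (hev k).sub (integrable_const _)]
      have (k : Fin n) : ∫ S', (g i (S' k) - g i (S k)) ∂P = ∫ z, g i z ∂D - g i (S k) := by
        rw [integral_sub (hev k) (integrable_const _), hP,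
          integral_comp_eval (μ := fun _ : Fin n => D) (hgm i).aestronglyMeasurable]
        simp
      simp [this, sum_sub_distrib]
    have h2 : ∫ S', ∑ k, (g i (S' k) - g i (S k)) ∂P ≤
        ∫ S', ghostDeviation g (fun k => (S k, S' k)) ∂P :=
      integral_mono (integrable_finsetSum _ fun k _ => (hev k).sub (integrable_const _)) (hΨi S)
        fun S' => le_ciSup (bddAbove_ghost hg fun k => (S k, S' k)) i
    have h3 := mul_le_mul_of_nonneg_left (h1 ▸ h2) (by positivity : (0 : ℝ) ≤ 1 / n)
    refine le_trans (le_of_eq ?_) h3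
    field_simp
  set t := B * Real.sqrt (Real.log (1 / δ) / (2 * n)) with ht
  have hlog : 0 ≤ Real.log (1 / δ) := Real.log_nonneg (by rw [le_div_iff₀ hδ]; linarith)
  have ht0 : 0 ≤ t := by positivity
  have htail := (hasSubgaussianMGF_of_bounded_differences (D := D) hMm hMb hdiff).measure_ge_le ht0
  -- The variance proxy is `B² / (4n)`; `t` is the level at which the tail equals `δ`.
  have hexp : Real.exp (-t ^ 2 / (2 * ((n * (b / 2) ^ 2 : ℝ≥0) : ℝ))) = δ := by
    have h1 : t ^ 2 = B ^ 2 * (Real.log (1 / δ) / (2 * n)) := by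
      rw [ht, mul_pow, Real.sq_sqrt (by positivity)]
    have h2 : ((n * (b / 2) ^ 2 : ℝ≥0) : ℝ) = n * (B / n / 2) ^ 2 := by
      push_cast; rfl
    have h3 : -t ^ 2 / (2 * ((n * (b / 2) ^ 2 : ℝ≥0) : ℝ)) = Real.log δ := by
      rw [h1, h2, one_div, Real.log_inv]
      field_simp
    rw [h3, Real.exp_log hδ]
  rw [hexp] at htail
  set A := {S | t ≤ M S - ∫ S', M S' ∂P} with hA
  have hAm : MeasurableSet A := measurableSet_le measurable_const (hMm.sub_const _)
  refine ⟨Aᶜ, hAm.compl, ?_, fun S hS i => ?_⟩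
  · rw [prob_compl_eq_one_sub hAm, ENNReal.ofReal_sub _ hδ.le, ENNReal.ofReal_one]
    refine tsub_le_tsub_left ?_ 1
    rw [← ENNReal.ofReal_toReal (measure_ne_top P A)]
    exact ENNReal.ofReal_le_ofReal htail
  · have h1 : M S - ∫ S', M S' ∂P < t := not_le.1 hS
    have h2 := hrisk S i
    linarith

end Symmetrization

/-! ### Measurability and reduction to countable suprema -/

lemma continuous_weightNorm {H : Type*} [NormedAddCommGroup H] {c : ℕ} :
    Continuous (weightNorm : (Fin c → H) → ℝ) := by
  unfold weightNorm
  fun_prop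

section Kernel

variable {X H : Type*} [NormedAddCommGroup H] [InnerProductSpace ℝ H]

/-- The functions of the class of a measurable kernel are measurable,
even if the feature map is not. -/
lemma measurable_inner_feature [MeasurableSpace X] [CompleteSpace H] {κ : X → X → ℝ}
    (hκm : Measurable (Function.uncurry κ)) {φ : X → H}
    (hφ : ∀ x x', inner ℝ (φ x) (φ x') = κ x x') (w : H) :
    Measurable fun x => (inner ℝ w (φ x) : ℝ) := by
  -- Projecting `w` onto the closed span of the features keeps all scores, and a vector there is a
  -- limit of finite combinations, whose scores are kernel sums.
  set K := (Submodule.span ℝ (Set.range φ)).topologicalClosure with hK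
  have hspan : ∀ u ∈ Submodule.span ℝ (Set.range φ), Measurable fun x => (inner ℝ u (φ x) : ℝ) := by
    intro u hu
    induction hu using Submodule.span_induction with
    | mem u hu =>
      obtain ⟨x', rfl⟩ := hu
      simp only [hφ]
      exact hκm.comp (measurable_const.prodMk measurable_id)
    | zero => simp
    | add u v _ _ hu hv =>
      simp only [inner_add_left]
      exact hu.add hv
    | smul a u _ hu =>
      simp only [real_inner_smul_left]
      exact hu.const_mul a
  have hproj : (K.starProjection w : H) ∈ K := Submodule.starProjection_apply_mem K w
  have heq (x : X) : (inner ℝ w (φ x) : ℝ) = inner ℝ (K.starProjection w) (φ x) := by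
    have hx : φ x ∈ K := Submodule.le_topologicalClosure _ (Submodule.subset_span ⟨x, rfl⟩)
    rw [Submodule.inner_starProjection_left_eq_right, Submodule.starProjection_eq_self_iff.2 hx]
  simp only [heq]
  obtain ⟨u, hu, hlim⟩ := mem_closure_iff_seq_limit.1
    (show K.starProjection w ∈ closure (Submodule.span ℝ (Set.range φ) : Set H) from hproj)
  refine measurable_of_tendsto_metrizable (fun n => hspan (u n) (hu n)) ?_
  rw [tendsto_pi_nhds]
  exact fun x => hlim.inner tendsto_const_nhds

variable {c : ℕ} {Λ : ℝ}

lemma weightNorm_smul (s : ℝ) (W : Fin c → H) : weightNorm (s • W) = |s| * weightNorm W := by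
  simp only [weightNorm, Pi.smul_apply, norm_smul, mul_pow, ← mul_sum]
  rw [Real.sqrt_mul (sq_nonneg _), Real.sqrt_sq (norm_nonneg s), Real.norm_eq_abs]

/-- Radial retraction onto the tuples of weight norm at most `Λ`. -/
noncomputable def clip (Λ : ℝ) (W : Fin c → H) : Fin c → H := (Λ / max Λ (weightNorm W)) • W

lemma weightNorm_clip_le (hΛ : 0 ≤ Λ) (W : Fin c → H) : weightNorm (clip Λ W) ≤ Λ := by
  have h0 := weightNorm_nonneg W
  rw [clip, weightNorm_smul, abs_of_nonneg (div_nonneg hΛ (hΛ.trans (le_max_left _ _))),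
    div_mul_eq_mul_div]
  exact div_le_of_le_mul₀ (hΛ.trans (le_max_left _ _)) hΛ
    (mul_le_mul_of_nonneg_left (le_max_right _ _) hΛ)

lemma clip_of_le {W : Fin c → H} (hW : weightNorm W ≤ Λ) : clip Λ W = W := by
  rw [clip, max_eq_left hW]
  -- At `Λ = 0` the factor is `0 / 0 = 0`, which is harmless because `W` must vanish.
  rcases eq_or_ne Λ 0 with rfl | h
  · ext j
    have := (norm_le_weightNorm W j).trans hW
    simp [norm_le_zero_iff.1 this]
  · rw [div_self h, one_smul]

lemma continuous_clip (hΛ : 0 ≤ Λ) : Continuous (clip Λ : (Fin c → H) → Fin c → H) := by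
  unfold clip
  rcases hΛ.eq_or_lt with rfl | h
  · simpa using continuous_const
  · exact (continuous_const.div (continuous_const.max continuous_weightNorm)
      fun W => (h.trans_le (le_max_left _ _)).ne').smul continuous_id

variable {ι : Type*} [Fintype ι]

/-- Weight tuples in the span of finitely many feature vectors. -/
noncomputable def spanWeights (v : ι → H) (a : Fin c → ι → ℝ) : Fin c → H :=
  fun j => ∑ i, a j i • v i

lemma continuous_spanWeights (v : ι → H) :
    Continuous (spanWeights v : (Fin c → ι → ℝ) → Fin c → H) := by
  unfold spanWeights
  fun_prop

/-- Every weight tuple of the class has the same scores on finitely many feature vectors as some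
tuple of the class in their span. -/
lemma exists_spanWeights (v : ι → H) {W : Fin c → H} (hW : weightNorm W ≤ Λ) :
    ∃ a : Fin c → ι → ℝ, weightNorm (spanWeights v a) ≤ Λ ∧
      ∀ j i, (inner ℝ (spanWeights v a j) (v i) : ℝ) = inner ℝ (W j) (v i) := by
  -- Projection onto the span of the features preserves the scores and does not increase the norms.
  set K := Submodule.span ℝ (Set.range v) with hK
  have : FiniteDimensional ℝ K := FiniteDimensional.span_of_finite ℝ (Set.finite_range v)
  have hmem (j : Fin c) : ∃ a : ι → ℝ, ∑ i, a i • v i = K.starProjection (W j) :=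
    (Submodule.mem_span_range_iff_exists_fun ℝ).1 (Submodule.starProjection_apply_mem K (W j))
  choose a ha using hmem
  have hs : spanWeights v a = fun j => K.starProjection (W j) := funext ha
  refine ⟨a, le_trans ?_ hW, fun j i => ?_⟩
  · rw [hs]
    exact Real.sqrt_le_sqrt (sum_le_sum fun j _ => pow_le_pow_left₀ (norm_nonneg _)
      (K.norm_starProjection_apply_le (W j)) 2)
  · have hx : v i ∈ K := Submodule.subset_span ⟨i, rfl⟩
    rw [hs, Submodule.inner_starProjection_left_eq_right,
      Submodule.starProjection_eq_self_iff.2 hx]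

/-- A continuous functional of the scores on finitely many feature vectors has the same supremum
over the class as over a countable family of clipped rational combinations. -/
lemma iSup_weights_eq_iSup_rat (hΛ : 0 ≤ Λ) (v : ι → H) {F : (Fin c → ι → ℝ) → ℝ}
    (hF : Continuous F)
    (hb : BddAbove (Set.range fun W : Weights H c Λ => F fun j i => inner ℝ (W.1 j) (v i))) :
    ⨆ W : Weights H c Λ, F (fun j i => inner ℝ (W.1 j) (v i)) =
      ⨆ a : Fin c → ι → ℚ, F fun j i =>
        inner ℝ (clip Λ (spanWeights v fun j i => (a j i : ℝ)) j) (v i) := by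
  have : Nonempty (Weights H c Λ) := ⟨⟨_, weightNorm_clip_le hΛ 0⟩⟩
  have hmem (b : Fin c → ι → ℝ) :
      F (fun j i => inner ℝ (clip Λ (spanWeights v b) j) (v i)) ∈
        Set.range fun W : Weights H c Λ => F fun j i => inner ℝ (W.1 j) (v i) :=
    ⟨⟨_, weightNorm_clip_le hΛ (spanWeights v b)⟩, rfl⟩
  have hb' : BddAbove (Set.range fun a : Fin c → ι → ℚ => F fun j i =>
      inner ℝ (clip Λ (spanWeights v fun j i => (a j i : ℝ)) j) (v i)) :=
    hb.mono (by rintro _ ⟨a, rfl⟩; exact hmem _)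
  refine le_antisymm (ciSup_le fun W => ?_) (ciSup_le fun a => le_csSup hb (hmem _))
  obtain ⟨b, hbn, hbW⟩ := exists_spanWeights v W.2
  have hcont : Continuous fun b : Fin c → ι → ℝ =>
      F fun j i => inner ℝ (clip Λ (spanWeights v b) j) (v i) := by
    refine hF.comp (continuous_pi fun j => continuous_pi fun i => ?_)
    exact ((continuous_apply j).comp ((continuous_clip hΛ).comp
      (continuous_spanWeights v))).inner continuous_const
  -- Clipping sends every coefficient array into the class, so density of rationals in the whole
  -- space suffices, not in the constraint set.
  have hdense : DenseRange fun (a : Fin c → ι → ℚ) j i => (a j i : ℝ) :=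
    DenseRange.piMap fun _ => DenseRange.piMap fun _ => Rat.denseRange_cast
  have hle := hdense.induction_on (p := fun b : Fin c → ι → ℝ =>
      F (fun j i => inner ℝ (clip Λ (spanWeights v b) j) (v i)) ≤
        ⨆ a : Fin c → ι → ℚ, F fun j i =>
          inner ℝ (clip Λ (spanWeights v fun j i => (a j i : ℝ)) j) (v i)) b
    (isClosed_le hcont continuous_const) fun a => le_ciSup hb' a
  simp only [clip_of_le hbn, hbW] at hle
  exact hle

lemma inner_spanWeights {κ : X → X → ℝ} {φ : X → H}
    (hφ : ∀ x x', inner ℝ (φ x) (φ x') = κ x x') (x : ι → X) (a : Fin c → ι → ℝ) (j : Fin c)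
    (x' : X) :
    (inner ℝ (spanWeights (fun i => φ (x i)) a j) (φ x') : ℝ) = ∑ i, a j i * κ (x i) x' := by
  simp only [spanWeights, sum_inner, real_inner_smul_left, hφ]

/-- The norm, hence the clipping factor, involves the features only through kernel values, which are
measurable. -/
lemma weightNorm_spanWeights {κ : X → X → ℝ} {φ : X → H}
    (hφ : ∀ x x', inner ℝ (φ x) (φ x') = κ x x') (x : ι → X) (a : Fin c → ι → ℝ) :
    weightNorm (spanWeights (fun i => φ (x i)) a) =
      Real.sqrt (∑ j, ∑ i, ∑ i', a j i * a j i' * κ (x i) (x i')) := by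
  unfold weightNorm
  congr 1
  refine sum_congr rfl fun j _ => ?_
  rw [← real_inner_self_eq_norm_sq]
  conv_lhs => rw [spanWeights, sum_inner]
  refine sum_congr rfl fun i _ => ?_
  rw [inner_sum]
  refine sum_congr rfl fun i' _ => ?_
  rw [real_inner_smul_left, real_inner_smul_right, hφ, mul_assoc]

/-- The scores of clipped combinations depend measurably on the points. -/
lemma measurable_inner_clip [MeasurableSpace X] {κ : X → X → ℝ}
    (hκm : Measurable (Function.uncurry κ)) {φ : X → H}
    (hφ : ∀ x x', inner ℝ (φ x) (φ x') = κ x x') {Ω : Type*} [MeasurableSpace Ω]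
    {x : Ω → ι → X} (hx : ∀ i, Measurable fun ω => x ω i) (a : Fin c → ι → ℝ) (j : Fin c) (i : ι) :
    Measurable fun ω =>
      (inner ℝ (clip Λ (spanWeights (fun i => φ (x ω i)) a) j) (φ (x ω i)) : ℝ) := by
  have hk (i i' : ι) : Measurable fun ω => κ (x ω i) (x ω i') :=
    hκm.comp ((hx i).prodMk (hx i'))
  simp only [clip, Pi.smul_apply, real_inner_smul_left, inner_spanWeights hφ,
    weightNorm_spanWeights hφ]
  refine Measurable.mul ?_ (Finset.measurable_fun_sum _ fun i' _ => (hk i' i).const_mul _)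
  refine measurable_const.div (measurable_const.max (Measurable.sqrt ?_))
  exact Finset.measurable_fun_sum _ fun j _ => Finset.measurable_fun_sum _ fun i _ =>
    Finset.measurable_fun_sum _ fun i' _ => (hk i i').const_mul _

end Kernel

/-! ### The losses: comparison, range, measurability -/

lemma measurable_labelVal : Measurable labelVal :=
  (measurable_from_top (f := fun k : ℤ => (k : ℝ))).comp (comap_measurable Units.val)

instance : MeasurableSingletonClass ℤˣ where
  measurableSet_singleton u := ⟨{(u : ℤ)}, measurableSet_singleton _, by ext; simp [Units.ext_iff]⟩

section Losses

variable {c : ℕ} {ℓ : ℝ → ℝ}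

lemma continuous_subsetLoss [NeZero c] (hℓ : Continuous ℓ) (y : Labels c) :
    Continuous fun v => subsetLoss ℓ v y := by
  unfold subsetLoss
  simp only [← Finset.sup'_univ_eq_ciSup]
  exact Continuous.finset_sup'_apply _ fun j _ => by fun_prop

lemma measurable_subsetLoss {Ω : Type*} [MeasurableSpace Ω] (hℓ : Continuous ℓ)
    {v : Ω → Fin c → ℝ} (hv : ∀ j, Measurable fun ω => v ω j) {y : Ω → Labels c}
    (hy : Measurable y) : Measurable fun ω => subsetLoss ℓ (v ω) (y ω) :=
  Measurable.iSup fun j => hℓ.measurable.comp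
    ((measurable_labelVal.comp ((measurable_pi_apply j).comp hy)).mul (hv j))

variable {X H : Type*} [NormedAddCommGroup H] [InnerProductSpace ℝ H]

/-- The surrogate subset losses of the functions in the kernel class. -/
noncomputable def kernelLoss (ℓ : ℝ → ℝ) (φ : X → H) (Λ : ℝ) (W : Weights H c Λ)
    (z : X × Labels c) : ℝ := subsetLoss ℓ (fun j => inner ℝ (W.1 j) (φ z.1)) z.2

lemma subsetLoss01_nonneg (h y : Labels c) : 0 ≤ subsetLoss01 h y :=
  Real.iSup_nonneg fun j => by split_ifs <;> norm_num

lemma subsetLoss01_le_one (h y : Labels c) : subsetLoss01 h y ≤ 1 :=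
  Real.iSup_le (fun j => by split_ifs <;> norm_num) zero_le_one

lemma rankingLoss01_nonneg (v : Fin c → ℝ) (y : Labels c) : 0 ≤ rankingLoss01 v y := by
  unfold rankingLoss01
  split_ifs
  · exact mul_nonneg (by positivity)
      (sum_nonneg fun p _ => sum_nonneg fun q _ => by split_ifs <;> norm_num)
  · exact le_rfl

lemma rankingLoss01_le_one (v : Fin c → ℝ) (y : Labels c) : rankingLoss01 v y ≤ 1 := by
  unfold rankingLoss01
  split_ifs
  · rw [one_div, inv_mul_eq_div]
    refine div_le_one_of_le₀ ?_ (by positivity)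
    calc _ ≤ ∑ p ∈ relevant y, ∑ q ∈ irrelevant y, (1 : ℝ) :=
          sum_le_sum fun p _ => sum_le_sum fun q _ => by split_ifs <;> norm_num
      _ = _ := by simp
  · exact zero_le_one

/-- The ranking loss is dominated by the subset loss of the signs. -/
lemma rankingLoss01_le_subsetLoss01 (v : Fin c → ℝ) (y : Labels c) :
    rankingLoss01 v y ≤ subsetLoss01 (sgnVec v) y := by
  by_cases h : ∀ j, sgnVec v j = y j
  · refine le_trans (le_of_eq ?_) (subsetLoss01_nonneg _ _)
    unfold rankingLoss01
    split_ifs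
    · refine mul_eq_zero_of_right _ (sum_eq_zero fun p hp => sum_eq_zero fun q hq => ?_)
      have hp' := h p
      have hq' := h q
      rw [(mem_filter.1 hp).2] at hp'
      rw [(mem_filter.1 hq).2] at hq'
      simp only [sgnVec, sgn] at hp' hq'
      have hp0 : 0 < v p := by
        by_contra h0
        rw [if_neg h0] at hp'
        exact absurd hp' (by decide)
      have hq0 : ¬ 0 < v q := fun h0 => by
        rw [if_pos h0] at hq'
        exact absurd hq' (by decide)
      exact if_neg (by linarith)
    · rfl
  · push Not at h
    obtain ⟨j, hj⟩ := h
    refine (rankingLoss01_le_one v y).trans ?_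
    have := le_ciSup (Set.finite_range fun j =>
      if sgnVec v j ≠ y j then (1 : ℝ) else 0).bddAbove j
    simpa [hj, subsetLoss01] using this

lemma subsetLoss01_le_subsetLoss
    (h01 : ∀ (v : ℝ) (y : ℤˣ), (if sgn v ≠ y then (1 : ℝ) else 0) ≤ ℓ (labelVal y * v))
    (v : Fin c → ℝ) (y : Labels c) : subsetLoss01 (sgnVec v) y ≤ subsetLoss ℓ v y :=
  ciSup_mono (Set.finite_range _).bddAbove fun j => h01 (v j) (y j)

/-- If the base loss dominates the 0/1 loss and is at most `B` on the margins of the class, then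
the losses of the class are in `[0, B]`. -/
lemma kernelLoss_mem_Icc [NeZero c] {φ : X → H} {Λ r B : ℝ} (hΛ : 0 ≤ Λ)
    (hφr : ∀ x, ‖φ x‖ ≤ r) (hB : ∀ u : ℝ, |u| ≤ Λ * r → ℓ u ≤ B)
    (h01 : ∀ (v : ℝ) (y : ℤˣ), (if sgn v ≠ y then (1 : ℝ) else 0) ≤ ℓ (labelVal y * v))
    (W : Weights H c Λ) (z : X × Labels c) : kernelLoss ℓ φ Λ W z ∈ Set.Icc 0 B := by
  refine ⟨(subsetLoss01_nonneg _ _).trans (subsetLoss01_le_subsetLoss h01 _ _),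
    ciSup_le fun j => hB _ ?_⟩
  rw [abs_mul, abs_labelVal, one_mul]
  exact abs_inner_weights_le hΛ W j (hφr z.1)

variable [MeasurableSpace X]

lemma measurable_ghostDeviation_kernelLoss [NeZero c] {n : ℕ} {κ : X → X → ℝ}
    (hκm : Measurable (Function.uncurry κ)) {φ : X → H}
    (hφ : ∀ x x', inner ℝ (φ x) (φ x') = κ x x') {Λ B : ℝ} (hΛ : 0 ≤ Λ) (hℓ : Continuous ℓ)
    (hg : ∀ (W : Weights H c Λ) z, kernelLoss ℓ φ Λ W z ∈ Set.Icc 0 B) :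
    Measurable (ghostDeviation (n := n) (kernelLoss (c := c) ℓ φ Λ)) := by
  -- Sample and ghost sample form one family of `2n` points, so a single finite span represents all
  -- scores involved.
  set pt : (Fin n → (X × Labels c) × (X × Labels c)) → Fin n ⊕ Fin n → X :=
    fun T => Sum.elim (fun k => (T k).1.1) fun k => (T k).2.1 with hpt
  have hpm (i) : Measurable fun T => pt T i := by
    rcases i with k | k <;> simp only [hpt, Sum.elim_inl, Sum.elim_inr] <;> fun_prop
  set F : (Fin n → (X × Labels c) × (X × Labels c)) → (Fin c → Fin n ⊕ Fin n → ℝ) → ℝ :=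
    fun T u => ∑ k, (subsetLoss ℓ (fun j => u j (.inr k)) (T k).2.2 -
      subsetLoss ℓ (fun j => u j (.inl k)) (T k).1.2) with hF
  have hFc (T) : Continuous (F T) := by
    refine continuous_finsetSum _ fun k _ => ?_
    exact ((continuous_subsetLoss hℓ _).comp (by fun_prop)).sub
      ((continuous_subsetLoss hℓ _).comp (by fun_prop))
  have heq : ghostDeviation (n := n) (kernelLoss (c := c) ℓ φ Λ) = fun T =>
      ⨆ a : Fin c → Fin n ⊕ Fin n → ℚ, F T fun j i =>
        inner ℝ (clip Λ (spanWeights (fun i => φ (pt T i)) fun j i => (a j i : ℝ)) j)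
          (φ (pt T i)) := by
    ext T
    exact iSup_weights_eq_iSup_rat hΛ (fun i => φ (pt T i)) (hFc T) (bddAbove_ghost hg T)
  rw [heq]
  refine Measurable.iSup fun a => Finset.measurable_fun_sum _ fun k _ => Measurable.sub ?_ ?_
  · exact measurable_subsetLoss hℓ (fun j => measurable_inner_clip hκm hφ hpm _ j (.inr k))
      (by fun_prop)
  · exact measurable_subsetLoss hℓ (fun j => measurable_inner_clip hκm hφ hpm _ j (.inl k))
      (by fun_prop)

lemma measurable_sgn : Measurable sgn :=
  Measurable.ite measurableSet_Ioi measurable_const measurable_const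

lemma measurable_subsetLoss01 {f : X → Fin c → ℝ} (hf : ∀ j, Measurable fun x => f x j) :
    Measurable fun z : X × Labels c => subsetLoss01 (sgnVec (f z.1)) z.2 := by
  refine measurable_from_prod_countable_left fun y => Measurable.iSup fun j => ?_
  exact Measurable.ite ((measurable_sgn.comp (hf j)) (measurableSet_singleton (y j)).compl)
    measurable_const measurable_const

lemma measurable_rankingLoss01 {f : X → Fin c → ℝ} (hf : ∀ j, Measurable fun x => f x j) :
    Measurable fun z : X × Labels c => rankingLoss01 (f z.1) z.2 := by
  refine measurable_from_prod_countable_left fun y => ?_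
  simp only [rankingLoss01]
  split_ifs
  · exact (Finset.measurable_fun_sum _ fun p _ => Finset.measurable_fun_sum _ fun q _ =>
      Measurable.ite (measurableSet_le (hf p) (hf q)) measurable_const measurable_const).const_mul _
  · exact measurable_const

end Losses

end MultiLabel

/-! ### Assembly of the bound -/

open MeasureTheory in
theorem mainTheorem9
    {d c n : ℕ} (hc : 0 < c) (hn : 0 < n)
    -- the input space and the distribution of (input, label vector)
    (X : Set (EuclideanSpace ℝ (Fin d)))
    (D : MeasureTheory.Measure (X × MultiLabel.Labels c)) [MeasureTheory.IsProbabilityMeasure D]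
    -- the kernel and a feature map of it
    (κ : X → X → ℝ) (hκ : (Matrix.of κ).PosSemidef)
    (hκm : Measurable (Function.uncurry κ))
    {H : Type*} [NormedAddCommGroup H] [InnerProductSpace ℝ H] [CompleteSpace H]
    (φ : X → H) (hφ : ∀ x x', inner ℝ (φ x) (φ x') = κ x x')
    (Λ r : ℝ) (hr : 0 < r) (hκr : ∀ x, κ x x ≤ r ^ 2)
    -- the base loss: Lipschitz, above the 0/1 loss, bounded at all margins of the class
    (ℓ : ℝ → ℝ) (ρ : ℝ≥0) (hρ : LipschitzWith ρ ℓ)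
    (B : ℝ) (hB : ∀ u : ℝ, |u| ≤ Λ * r → ℓ u ≤ B)
    (h01 : ∀ (v : ℝ) (y : ℤˣ),
      (if MultiLabel.sgn v ≠ y then (1 : ℝ) else 0) ≤ ℓ (MultiLabel.labelVal y * v))
    (δ : ℝ) (hδ : 0 < δ) :
    -- the two 0/1 losses are integrable, so that the risks below are genuine expectations
    (∀ f ∈ MultiLabel.kernelClass c φ Λ,
      MeasureTheory.Integrable (fun z => MultiLabel.rankingLoss01 (f z.1) z.2) D ∧
      MeasureTheory.Integrable
        (fun z => MultiLabel.subsetLoss01 (MultiLabel.sgnVec (f z.1)) z.2) D) ∧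
    -- with probability at least 1 - δ over the i.i.d. sample S, uniformly over the class
    ∃ E : Set (Fin n → X × MultiLabel.Labels c), MeasurableSet E ∧
      ENNReal.ofReal (1 - δ) ≤ MeasureTheory.Measure.pi (fun _ : Fin n => D) E ∧
      ∀ S ∈ E, ∀ f ∈ MultiLabel.kernelClass c φ Λ,
        MultiLabel.risk D (fun z => MultiLabel.rankingLoss01 (f z.1) z.2) ≤
          MultiLabel.risk D
            (fun z => MultiLabel.subsetLoss01 (MultiLabel.sgnVec (f z.1)) z.2) ∧
        MultiLabel.risk D
            (fun z => MultiLabel.subsetLoss01 (MultiLabel.sgnVec (f z.1)) z.2) ≤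
          MultiLabel.empiricalRisk S (fun z => MultiLabel.subsetLoss ℓ (f z.1) z.2) +
            2 * Real.sqrt 2 * (ρ : ℝ) * Real.sqrt ((c : ℝ) * Λ ^ 2 * r ^ 2 / (n : ℝ)) +
            3 * B * Real.sqrt (Real.log (2 / δ) / (2 * (n : ℝ))) := by
  have : NeZero c := ⟨hc.ne'⟩
  have hφr (x : X) : ‖φ x‖ ≤ r := by
    refine le_of_sq_le_sq ?_ hr.le
    rw [← real_inner_self_eq_norm_sq, hφ]
    exact hκr x
  have hmeas (w : H) : Measurable fun x => (inner ℝ w (φ x) : ℝ) :=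
    MultiLabel.measurable_inner_feature hκm hφ w
  have hint : ∀ f ∈ MultiLabel.kernelClass c φ Λ,
      Integrable (fun z => MultiLabel.rankingLoss01 (f z.1) z.2) D ∧
      Integrable (fun z => MultiLabel.subsetLoss01 (MultiLabel.sgnVec (f z.1)) z.2) D := by
    rintro f ⟨W, -, rfl⟩
    exact ⟨Integrable.of_mem_Icc 0 1
        (MultiLabel.measurable_rankingLoss01 fun j => hmeas (W j)).aemeasurable
        (ae_of_all _ fun z => ⟨MultiLabel.rankingLoss01_nonneg _ _,
          MultiLabel.rankingLoss01_le_one _ _⟩),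
      Integrable.of_mem_Icc 0 1
        (MultiLabel.measurable_subsetLoss01 fun j => hmeas (W j)).aemeasurable
        (ae_of_all _ fun z => ⟨MultiLabel.subsetLoss01_nonneg _ _,
          MultiLabel.subsetLoss01_le_one _ _⟩)⟩
  refine ⟨hint, ?_⟩
  rcases le_or_gt 1 δ with hδ1 | hδ1
  · exact ⟨∅, MeasurableSet.empty, by simp [ENNReal.ofReal_eq_zero.2 (sub_nonpos.2 hδ1)],
      fun S hS => absurd hS (Set.notMem_empty S)⟩
  rcases lt_or_ge Λ 0 with hΛ | hΛ
  · refine ⟨Set.univ, MeasurableSet.univ, by simp [hδ.le], fun S _ f hf => ?_⟩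
    obtain ⟨W, hW, -⟩ := hf
    exact absurd (MultiLabel.weightNorm_nonneg W) (by linarith)
  have hne : Nonempty (MultiLabel.Weights H c Λ) := ⟨⟨_, MultiLabel.weightNorm_clip_le hΛ 0⟩⟩
  -- Since `sgn 0 = -1`, label `1` is misclassified at score `0`, so `1 ≤ ℓ 0 ≤ B`.
  have hB0 : 0 < B := by
    have h1 : (1 : ℝ) ≤ ℓ 0 := by simpa [MultiLabel.sgn] using h01 0 1
    linarith [hB 0 (by rw [abs_zero]; positivity)]
  have hg := MultiLabel.kernelLoss_mem_Icc (c := c) hΛ hφr hB h01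
  have hgm (W : MultiLabel.Weights H c Λ) : Measurable (MultiLabel.kernelLoss ℓ φ Λ W) :=
    MultiLabel.measurable_subsetLoss hρ.continuous
      (fun j => (hmeas (W.1 j)).comp measurable_fst) measurable_snd
  obtain ⟨E, hE, hPE, hbound⟩ := MultiLabel.exists_measurableSet_uniform_deviation (D := D)
    (g := MultiLabel.kernelLoss (c := c) ℓ φ Λ) hn hgm hB0 hg
    (MultiLabel.measurable_ghostDeviation_kernelLoss hκm hφ hΛ hρ.continuous hg)
    (fun S => MultiLabel.expect_iSup_subsetLoss_le hρ (fun k => φ (S k).1) (fun k => hφr _)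
      (fun k => (S k).2) fun k => ⟨B, fun W =>
        (abs_of_nonneg (hg W (S k)).1).trans_le (hg W (S k)).2⟩) hδ hδ1
  refine ⟨E, hE, hPE, fun S hS f hf => ?_⟩
  obtain ⟨hi1, hi2⟩ := hint f hf
  refine ⟨integral_mono hi1 hi2 fun z => MultiLabel.rankingLoss01_le_subsetLoss01 _ _, ?_⟩
  obtain ⟨W, hW, rfl⟩ := hf
  have hn' : (0 : ℝ) < n := by exact_mod_cast hn
  have hrisk : MultiLabel.risk D (fun z => MultiLabel.subsetLoss01
      (MultiLabel.sgnVec fun j => inner ℝ (W j) (φ z.1)) z.2) ≤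
      ∫ z, MultiLabel.kernelLoss ℓ φ Λ ⟨W, hW⟩ z ∂D :=
    integral_mono hi2 (Integrable.of_mem_Icc 0 B (hgm ⟨W, hW⟩).aemeasurable
      (ae_of_all _ fun z => hg ⟨W, hW⟩ z)) fun z => MultiLabel.subsetLoss01_le_subsetLoss h01 _ _
  have hcomplexity : 2 * (Real.sqrt 2 * ρ * (Λ * Real.sqrt (c * n * r ^ 2))) / n =
      2 * Real.sqrt 2 * (ρ : ℝ) * Real.sqrt ((c : ℝ) * Λ ^ 2 * r ^ 2 / (n : ℝ)) := by
    have : Real.sqrt ((c : ℝ) * Λ ^ 2 * r ^ 2 / (n : ℝ)) =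
        Λ * Real.sqrt (c * n * r ^ 2) / n := by
      rw [show (c : ℝ) * Λ ^ 2 * r ^ 2 / (n : ℝ) = (Λ / n) ^ 2 * (c * n * r ^ 2) by field_simp,
        Real.sqrt_mul (sq_nonneg _), Real.sqrt_sq (by positivity)]
      ring
    rw [this]
    ring
  -- The deviation bound gives the smaller term with `log (1 / δ)` and factor `B`; it is only
  -- relaxed here.
  have hconf : B * Real.sqrt (Real.log (1 / δ) / (2 * n)) ≤
      3 * B * Real.sqrt (Real.log (2 / δ) / (2 * (n : ℝ))) := by
    have h1 : Real.sqrt (Real.log (1 / δ) / (2 * n)) ≤ Real.sqrt (Real.log (2 / δ) / (2 * n)) := by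
      refine Real.sqrt_le_sqrt (div_le_div_of_nonneg_right ?_ (by positivity))
      exact Real.log_le_log (by positivity) (div_le_div_of_nonneg_right (by norm_num) hδ.le)
    have h2 := mul_le_mul_of_nonneg_left h1 hB0.le
    have h3 : 0 ≤ B * Real.sqrt (Real.log (2 / δ) / (2 * n)) := by positivity
    linarith
  have hb := hbound S hS ⟨W, hW⟩
  rw [hcomplexity] at hb
  exact hrisk.trans (hb.trans (add_le_add_right hconf _))
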